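/- **Setting.** *Smooth spaces.* $\mathbf C^\infty$ is the category of diffeological spaces: an object is a set $X$ with, for every open $U\subseteq\mathbb R^u$ ($u\in\mathbb N$), a set of figures $U\to X$ that contains the constants, is closed under precomposition with smooth maps between open sets, and has the sheaf property; arrows are the maps that take figures to figures. $X$ carries the final topology of its figures. A smooth manifold is an object of $\mathbf C^\infty$ whose figures are the smooth maps. An observable of $X$ is an arrow $\varphi:A\to K$ of $\mathbf C^\infty$ from an open subspace $A$ of $X$ to an open $K\subseteq\mathbb R^k$. *Extended points.* A path $x:\mathbb R\to X$, continuous at $0$, is nilpotent if for every observable $\varphi:A\to K$ with $x(0)\in A$ there is $j\in\mathbb N$ with $\|\varphi(x_t)-\varphi(x_0)\|^j=o(t)$ as $t\to0$. For nilpotent paths, $x\sim y$ means that for every observable $\varphi:A\to K$ one has $x_0\in A\iff y_0\in A$, and in this case $\varphi(x_t)=\varphi(y_t)+o(t)$. Let ${}^\bullet X$ be the set of nilpotent paths modulo $\sim$; for an arrow $f$ let ${}^\bullet f([x])=[f\circ x]$. For $V\subseteq\mathbb R^n$ open, ${}^\bullet V$ is identified with a subset of ${}^\bullet(\mathbb R^n)$,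 and a point of $V$ with the class of its constant path. Let $D=\{[h]\in{}^\bullet\mathbb R : h(t)=O(t)\text{ as }t\to 0\}$. *Extended spaces.* Let $\mathbf S$ be the category of all subsets $S\subseteq{}^\bullet(\mathbb R^s)$, $s\in\mathbb N$, with the topology given by the sets $S\cap{}^\bullet V$ ($V\subseteq\mathbb R^s$ open); its arrows $f:S\to T\subseteq{}^\bullet(\mathbb R^t)$ are the maps that, near every point of $S$, have the form $f(x)={}^\bullet g\langle p,x\rangle$ for $x\in S\cap{}^\bullet V$, with $g:U\times V\to\mathbb R^t$ an ordinary smooth map ($U\subseteq\mathbb R^q$, $V\subseteq\mathbb R^s$ open) and a fixed parameter $p\in{}^\bullet U$. The category ${}^\bullet\mathbf C^\infty$ is defined like $\mathbf C^\infty$, with $\mathbf S$ in place of the category of open sets and smooth maps; for $S\in\mathbf S$, $\bar S$ denotes the object with support set $S$ whose figures are the arrows of $\mathbf S$ into $S$. Products have as figures the pairs of figures. The exponential $Y^X$ is the set of arrows $X\to Y$; a map $d:S\to Y^X$ is a figure iff $(s,x)\mapsto d(s)(x)$ is an arrow $\bar S\times X\to Y$. For $X\in\mathbf C^\infty$, a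 subset $Z\subseteq{}^\bullet X$ is an object of ${}^\bullet\mathbf C^\infty$ whose figures are the maps that are locally of the form $d\circ f$, with $f:S'\to T$ an arrow of $\mathbf S$ and $d:T\to Z$ either constant or the restriction ${}^\bullet h|_T$ for a figure $h:V\to X$ of $X$ with $T\subseteq{}^\bullet V$. In particular ${}^\bullet X$ and $D\subseteq{}^\bullet\mathbb R$ are objects of ${}^\bullet\mathbf C^\infty$. *Standard tangent vectors.* For a smooth manifold $M$ put $\mathrm TM:=({}^\bullet M)^D$. The object $\mathrm T_{\rm st}M$ of $\mathbf C^\infty$ has support set $\{{}^\bullet f|_D : f\in\mathbf C^\infty(\mathbb R,M)\}\subseteq\mathrm TM$, and a map $d:U\to|\mathrm T_{\rm st}M|$, with $U\subseteq\mathbb R^u$ open, is a figure iff its composition with the inclusion into $\mathrm TM$ is a figure of $\mathrm TM$ of type $U$, where $U\subseteq{}^\bullet(\mathbb R^u)$ is regarded as a set of standard points. **Theorem.** Let $M$ be a finite-dimensional smooth manifold without boundary (no hypothesis is made on its topology). Then, in the category $\mathbf C^\infty$, the object $\mathrm T_{\rm st}M$ is isomorphic to the usual tangent bundle of $M$ (the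 smooth manifold of all tangent vectors of $M$). More precisely, there is an isomorphism of $\mathbf C^\infty$ which sends ${}^\bullet f|_D$ to the velocity vector $f'(0)\in T_{f(0)}M$, for every smooth curve $f:\mathbb R\to M$. -/

import Mathlib

open Set Filter Topology TopologicalSpace Asymptotics
open scoped Manifold ContDiff

noncomputable section

namespace InfDiffGeo

universe u v w

/-- The space `ℝⁿ`. -/
abbrev Euc (n : ℕ) : Type := EuclideanSpace ℝ (Fin n)

/-! ## The category `C^∞` (diffeological spaces) -/

/-- An object of the category `C^∞`: a set together with, for every open set `U` of every `ℝⁿ`,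
a set of *figures* `U → X`, closed under smooth reparametrisation, containing the constant maps,
and satisfying the sheaf condition. -/
structure CInfSpace : Type (u + 1) where
  carrier : Type u
  IsFig : ∀ {n : ℕ} (U : Opens (Euc n)), (U → carrier) → Prop
  fig_comp : ∀ {m n : ℕ} {U : Opens (Euc m)} {V : Opens (Euc n)} {d : V → carrier} {f : U → V},
    IsFig V d → ContMDiff 𝓘(ℝ, Euc m) 𝓘(ℝ, Euc n) ∞ f → IsFig U (d ∘ f)
  fig_const : ∀ {n : ℕ} (U : Opens (Euc n)) (x : carrier), IsFig U (fun _ => x)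
  fig_local : ∀ {n : ℕ} {U : Opens (Euc n)} {d : U → carrier},
    (∀ x : U, ∃ (V : Opens (Euc n)) (hV : V ≤ U), x.1 ∈ V ∧ IsFig V (d ∘ Opens.inclusion hV)) →
      IsFig U d

instance : CoeSort CInfSpace.{u} (Type u) := ⟨CInfSpace.carrier⟩

namespace CInfSpace

/-- A map is an arrow of `C^∞` iff it takes figures to figures. -/
def IsHom (X : CInfSpace.{u}) (Y : CInfSpace.{v}) (f : X → Y) : Prop :=
  ∀ {n : ℕ} {U : Opens (Euc n)} {d : U → X}, X.IsFig U d → Y.IsFig U (f ∘ d)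

/-- Arrows of `C^∞`. -/
@[ext]
structure Hom (X : CInfSpace.{u}) (Y : CInfSpace.{v}) where
  toFun : X → Y
  isHom : IsHom X Y toFun

instance (X : CInfSpace.{u}) (Y : CInfSpace.{v}) : CoeFun (Hom X Y) (fun _ => X → Y) :=
  ⟨Hom.toFun⟩

/-- The identity arrow. -/
def Hom.id (X : CInfSpace.{u}) : Hom X X := ⟨fun x => x, fun h => h⟩

/-- Composition of arrows (first `f`, then `g`). -/
def Hom.comp {X : CInfSpace.{u}} {Y : CInfSpace.{v}} {Z : CInfSpace.{w}}
    (f : Hom X Y) (g : Hom Y Z) : Hom X Z :=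
  ⟨fun x => g (f x), fun h => g.isHom (f.isHom h)⟩

instance : CategoryTheory.Category CInfSpace.{u} where
  Hom X Y := Hom X Y
  id X := Hom.id X
  comp f g := Hom.comp f g

/-- The final topology on `X` for which all figures are continuous. -/
@[reducible]
def topology (X : CInfSpace.{u}) : TopologicalSpace X where
  IsOpen S := ∀ {n : ℕ} {U : Opens (Euc n)} {d : U → X}, X.IsFig U d → IsOpen (d ⁻¹' S)
  isOpen_univ := fun _ => isOpen_univ
  isOpen_inter := fun _ _ hs ht _ _ _ hd => (hs hd).inter (ht hd)
  isOpen_sUnion := fun s hs n U d hd => by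
    rw [preimage_sUnion]
    exact isOpen_biUnion fun t ht => hs t ht hd

/-- The subspace `(S ≺ X)` induced by `X` on a subset `S`. -/
def subspace (X : CInfSpace.{u}) (S : Set X) : CInfSpace.{u} where
  carrier := S
  IsFig U d := X.IsFig U (fun x => (d x).1)
  fig_comp hd hf := X.fig_comp hd hf
  fig_const U x := X.fig_const U x.1
  fig_local h := X.fig_local h

/-- The `C^∞` space of a smooth manifold `M`: its figures are the smooth maps `U → M`. -/
abbrev ofManifold {E : Type v} [NormedAddCommGroup E] [NormedSpace ℝ E] {H : Type w}
    [TopologicalSpace H] (I : ModelWithCorners ℝ E H) (M : Type u) [TopologicalSpace M]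
    [ChartedSpace H M] : CInfSpace.{u} where
  carrier := M
  IsFig {n} U d := ContMDiff 𝓘(ℝ, Euc n) I ∞ d
  fig_comp hd hf := hd.comp hf
  fig_const _ _ := contMDiff_const
  fig_local {n U d} h := by
    intro x
    obtain ⟨V, hV, hx, hd⟩ := h x
    have hd' := hd ⟨x.1, hx⟩
    have key : ContMDiffAt 𝓘(ℝ, Euc n) I ∞
        (fun y : (⟨Subtype.val ⁻¹' (V : Set (Euc n)), V.isOpen.preimage continuous_subtype_val⟩ :
          Opens U) => d y.1) ⟨x, hx⟩ := by
      let j : (⟨Subtype.val ⁻¹' (V : Set (Euc n)), V.isOpen.preimage continuous_subtype_val⟩ :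
          Opens U) → V := fun y => ⟨y.1.1, y.2⟩
      have hj : ContMDiff 𝓘(ℝ, Euc n) 𝓘(ℝ, Euc n) ∞ j := by
        rw [← ContMDiff.subtypeVal_comp_iff]
        exact ContMDiff.comp (g := (Subtype.val : U → Euc n)) (f := Subtype.val)
          contMDiff_subtype_val contMDiff_subtype_val
      exact ContMDiffAt.comp (x := (⟨x, hx⟩ : (⟨Subtype.val ⁻¹' (V : Set (Euc n)),
        V.isOpen.preimage continuous_subtype_val⟩ : Opens U))) (f := j) (g := d ∘ Opens.inclusion hV)
        hd' (hj _)
    exact contMDiffAt_subtype_iff.1 key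

/-- The `C^∞` space `ℝⁿ`. -/
abbrev euc (n : ℕ) : CInfSpace.{0} := ofManifold 𝓘(ℝ, Euc n) (Euc n)

/-- The `C^∞` space of an open set `K ⊆ ℝⁿ`. -/
abbrev ofOpen {n : ℕ} (K : Opens (Euc n)) : CInfSpace.{0} := ofManifold 𝓘(ℝ, Euc n) K

/-- The `C^∞` space `ℝ`. -/
abbrev real : CInfSpace.{0} := ofManifold 𝓘(ℝ, ℝ) ℝ

/-- A smooth map of manifolds is an arrow of `C^∞`. -/
def Hom.ofContMDiff {E : Type*} [NormedAddCommGroup E] [NormedSpace ℝ E] {H : Type*}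
    [TopologicalSpace H] {I : ModelWithCorners ℝ E H} {M : Type u} [TopologicalSpace M]
    [ChartedSpace H M] {E' : Type*} [NormedAddCommGroup E'] [NormedSpace ℝ E'] {H' : Type*}
    [TopologicalSpace H'] {J : ModelWithCorners ℝ E' H'} {N : Type v} [TopologicalSpace N]
    [ChartedSpace H' N] (f : M → N) (hf : ContMDiff I J ∞ f) :
    Hom (ofManifold I M) (ofManifold J N) :=
  ⟨f, fun hd => hf.comp hd⟩

/-- The inclusion of an open set of `ℝⁿ`. -/
def incl {n : ℕ} (V : Opens (Euc n)) : Hom (ofOpen V) (euc n) :=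
  Hom.ofContMDiff Subtype.val contMDiff_subtype_val

/-- A figure of type `V` of `X` is the same as an arrow from the space of `V` to `X`. -/
def homOfFig (X : CInfSpace.{u}) {n : ℕ} {V : Opens (Euc n)} (h : V → X) (hh : X.IsFig V h) :
    Hom (ofOpen V) X :=
  ⟨h, fun hd => X.fig_comp hh hd⟩

theorem Hom.continuous {X : CInfSpace.{u}} {Y : CInfSpace.{v}} (f : Hom X Y) :
    Continuous[X.topology, Y.topology] f.toFun :=
  @Continuous.mk _ _ X.topology Y.topology _ fun _ hs _ _ _ hd => hs (f.isHom hd)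

/-- `φ`, restricted to `U`, is an observable of `X` on the zone `UK`, i.e. `U` is open in `X`, `K` is
open in `ℝᵏ` and `φ|_U` is an arrow `(U ≺ X) → K` of `C^∞`. The values of `φ` off `U` are
irrelevant. -/
def IsObservable (X : CInfSpace.{u}) (U : Set X) {k : ℕ} (K : Opens (Euc k)) (φ : X → Euc k) :
    Prop :=
  IsOpen[X.topology] U ∧
    ∃ h : MapsTo φ U (K : Set (Euc k)), IsHom (X.subspace U) (ofOpen K) (h.restrict φ U K)

theorem IsObservable.comp {X : CInfSpace.{u}} {Y : CInfSpace.{v}} (f : Hom X Y) {U : Set Y} {k : ℕ}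
    {K : Opens (Euc k)} {φ : Y → Euc k} (h : Y.IsObservable U K φ) :
    X.IsObservable (f.toFun ⁻¹' U) K (φ ∘ f.toFun) := by
  obtain ⟨hU, hm, hh⟩ := h
  refine ⟨@IsOpen.preimage _ _ X.topology Y.topology _ f.continuous _ hU, fun x hx => hm hx, ?_⟩
  intro n V d hd
  exact hh (d := fun x => (⟨f (d x).1, (d x).2⟩ : U)) (f.isHom hd)

/-- `x ∈ C₀(X)`: the path `x : ℝ → X` is continuous at the origin. -/
def IsC0 (X : CInfSpace.{u}) (x : ℝ → X) : Prop :=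
  Tendsto x (𝓝 0) (@nhds _ X.topology (x 0))

/-- Nilpotent paths of `X`. -/
def IsNilpotentPath (X : CInfSpace.{u}) (x : ℝ → X) : Prop :=
  X.IsC0 x ∧ ∀ (U : Set X) {k : ℕ} (K : Opens (Euc k)) (φ : X → Euc k), X.IsObservable U K φ →
    x 0 ∈ U → ∃ j : ℕ, (fun t => ‖φ (x t) - φ (x 0)‖ ^ j) =o[𝓝 0] (fun t : ℝ => t)

/-- The relation `x ∼ y` in `X`. -/
def PathEq (X : CInfSpace.{u}) (x y : ℝ → X) : Prop :=
  ∀ (U : Set X) {k : ℕ} (K : Opens (Euc k)) (φ : X → Euc k), X.IsObservable U K φ →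
    (x 0 ∈ U ↔ y 0 ∈ U) ∧
      (x 0 ∈ U → (fun t => φ (x t) - φ (y t)) =o[𝓝 0] (fun t : ℝ => t))

theorem PathEq.refl (X : CInfSpace.{u}) (x : ℝ → X) : X.PathEq x x := by
  intro U k K φ _
  refine ⟨Iff.rfl, fun _ => ?_⟩
  simp

theorem PathEq.symm {X : CInfSpace.{u}} {x y : ℝ → X} (h : X.PathEq x y) : X.PathEq y x := by
  intro U k K φ hφ
  obtain ⟨h1, h2⟩ := h U K φ hφ
  refine ⟨h1.symm, fun hy => ?_⟩
  simpa using (h2 (h1.2 hy)).neg_left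

theorem PathEq.trans {X : CInfSpace.{u}} {x y z : ℝ → X} (h : X.PathEq x y) (h' : X.PathEq y z) :
    X.PathEq x z := by
  intro U k K φ hφ
  obtain ⟨h1, h2⟩ := h U K φ hφ
  obtain ⟨h3, h4⟩ := h' U K φ hφ
  refine ⟨h1.trans h3, fun hx => ?_⟩
  simpa using (h2 hx).add (h4 (h1.1 hx))

/-- Equality in the extension, on nilpotent paths. -/
def pathSetoid (X : CInfSpace.{u}) : Setoid {x : ℝ → X // X.IsNilpotentPath x} where
  r x y := X.PathEq x.1 y.1
  iseqv := ⟨fun x => PathEq.refl X x.1, PathEq.symm, PathEq.trans⟩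

/-- The set of points of the extension `•X`: nilpotent paths modulo `∼`. -/
def Ext (X : CInfSpace.{u}) : Type u := Quotient X.pathSetoid

/-- The nilpotent path `c` represents the extended point `x ∈ •X`. -/
def Represents {X : CInfSpace.{u}} (c : ℝ → X) (x : Ext X) : Prop :=
  ∃ hc : X.IsNilpotentPath c, (Quotient.mk X.pathSetoid ⟨c, hc⟩ : Ext X) = x

theorem exists_represents {X : CInfSpace.{u}} (x : Ext X) : ∃ c : ℝ → X, Represents c x := by
  obtain ⟨c, hc⟩ := Quotient.exists_rep x
  exact ⟨c.1, c.2, hc⟩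

theorem Represents.pathEq {X : CInfSpace.{u}} {c c' : ℝ → X} {x : Ext X} (h : Represents c x)
    (h' : Represents c' x) : X.PathEq c c' := by
  obtain ⟨hc, rfl⟩ := h
  obtain ⟨hc', h⟩ := h'
  exact (Quotient.exact h : X.PathEq c' c).symm

theorem Represents.eq {X : CInfSpace.{u}} {c c' : ℝ → X} {x y : Ext X} (h : Represents c x)
    (h' : Represents c' y) (hc : X.PathEq c c') : x = y := by
  obtain ⟨_, rfl⟩ := h
  obtain ⟨_, rfl⟩ := h'
  exact Quotient.sound hc

theorem Represents.of_pathEq {X : CInfSpace.{u}} {c c' : ℝ → X} {x : Ext X} (h : Represents c x)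
    (hc' : X.IsNilpotentPath c') (hc : X.PathEq c c') : Represents c' x := by
  obtain ⟨_, rfl⟩ := h
  exact ⟨hc', (Quotient.sound hc).symm⟩

theorem IsNilpotentPath.map {X : CInfSpace.{u}} {Y : CInfSpace.{v}} (f : Hom X Y) {x : ℝ → X}
    (hx : X.IsNilpotentPath x) : Y.IsNilpotentPath (fun t => f (x t)) := by
  constructor
  · have h1 := @Continuous.tendsto _ _ X.topology Y.topology _ f.continuous (x 0)
    have h2 : Tendsto x (𝓝 0) (@nhds _ X.topology (x 0)) := hx.1
    exact h1.comp h2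
  · intro U k K φ hφ h0
    exact hx.2 (f.toFun ⁻¹' U) K (φ ∘ f.toFun) (hφ.comp f) h0

theorem PathEq.map {X : CInfSpace.{u}} {Y : CInfSpace.{v}} (f : Hom X Y) {x y : ℝ → X}
    (h : X.PathEq x y) : Y.PathEq (fun t => f (x t)) (fun t => f (y t)) :=
  fun U _ K φ hφ => h (f.toFun ⁻¹' U) K (φ ∘ f.toFun) (hφ.comp f)

/-- The extension `•f : •X → •Y` of an arrow `f : X → Y` of `C^∞`. -/
def Ext.map {X : CInfSpace.{u}} {Y : CInfSpace.{v}} (f : Hom X Y) : Ext X → Ext Y :=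
  Quotient.map (fun x => ⟨fun t => f (x.1 t), x.2.map f⟩) fun _ _ h => PathEq.map f h

theorem Represents.map {X : CInfSpace.{u}} {Y : CInfSpace.{v}} (f : Hom X Y) {c : ℝ → X} {x : Ext X}
    (h : Represents c x) : Represents (fun t => f (c t)) (Ext.map f x) := by
  obtain ⟨hc, rfl⟩ := h
  exact ⟨hc.map f, rfl⟩

theorem Ext.map_comp {X : CInfSpace.{u}} {Y : CInfSpace.{v}} {Z : CInfSpace.{w}} (f : Hom X Y)
    (g : Hom Y Z) (x : Ext X) : Ext.map (f.comp g) x = Ext.map g (Ext.map f x) := by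
  obtain ⟨c, hc, rfl⟩ := exists_represents x
  rfl

theorem isNilpotentPath_const {X : CInfSpace.{u}} (x : X) : X.IsNilpotentPath (fun _ => x) := by
  refine ⟨@tendsto_const_nhds _ X.topology _ _ _, fun U k K φ _ _ => ⟨1, ?_⟩⟩
  simp

/-- The embedding of standard points: the class of the constant path. -/
def hat {X : CInfSpace.{u}} (x : X) : Ext X :=
  Quotient.mk X.pathSetoid ⟨fun _ => x, isNilpotentPath_const x⟩

theorem represents_hat {X : CInfSpace.{u}} (x : X) : Represents (fun _ => x) (hat x) :=
  ⟨isNilpotentPath_const x, rfl⟩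

/-! ### Extended points of `ℝⁿ` -/

theorem isFig_ofOpen_iff {m n : ℕ} {K : Opens (Euc n)} {V : Opens (Euc m)} {d : V → K} :
    (ofOpen K).IsFig V d ↔ (euc n).IsFig V (fun x => (d x).1) :=
  (ContMDiff.subtypeVal_comp_iff K d).symm

theorem isObservable_id {n : ℕ} (W : Opens (Euc n)) :
    (ofOpen W).IsObservable univ (⊤ : Opens (Euc n)) (Subtype.val : W → Euc n) := by
  refine ⟨@isOpen_univ _ (ofOpen W).topology, fun _ _ => trivial, ?_⟩
  intro m V d hd
  exact isFig_ofOpen_iff.2 ((isFig_ofOpen_iff (K := W) (d := fun x => (d x).1)).1 hd)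

theorem isObservable_euc_id (n : ℕ) :
    (euc n).IsObservable univ (⊤ : Opens (Euc n)) (fun x => x) := by
  refine ⟨@isOpen_univ _ (euc n).topology, fun _ _ => trivial, ?_⟩
  intro m V d hd
  exact isFig_ofOpen_iff.2 hd

theorem lipschitz_observable {n : ℕ} {W : Opens (Euc n)} {U : Set W} {k : ℕ} {K : Opens (Euc k)}
    {φ : W → Euc k} (h : (ofOpen W).IsObservable U K φ) {w : W} (hw : w ∈ U) :
    ∃ C : ℝ, 0 ≤ C ∧ ∃ N ∈ 𝓝 w, ∀ a ∈ N, ∀ b ∈ N, ‖φ a - φ b‖ ≤ C * ‖a.1 - b.1‖ := by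
  classical
  obtain ⟨hU, hm, hh⟩ := h
  have hUo : IsOpen U := hU (d := (id : W → W)) contMDiff_id
  let O : Opens (Euc n) := ⟨Subtype.val '' U, W.isOpen.isOpenMap_subtype_val _ hUo⟩
  have hOW : O ≤ W := by rintro _ ⟨x, _, rfl⟩; exact x.2
  have hmem : ∀ x : O, (⟨x.1, hOW x.2⟩ : W) ∈ U := by
    rintro ⟨_, ⟨x, hx, rfl⟩⟩; exact hx
  have hfig : ContMDiff 𝓘(ℝ, Euc n) 𝓘(ℝ, Euc n) ∞ (Opens.inclusion hOW) := contMDiff_inclusion hOW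
  have h1 := hh (d := fun x : O => (⟨⟨x.1, hOW x.2⟩, hmem x⟩ : U)) hfig
  replace h1 : ContMDiff 𝓘(ℝ, Euc n) 𝓘(ℝ, Euc k) ∞ (fun x : O => φ ⟨x.1, hOW x.2⟩) :=
    isFig_ofOpen_iff.1 h1
  let F : Euc n → Euc k := fun x => if hx : x ∈ W then φ ⟨x, hx⟩ else 0
  have hwO : w.1 ∈ O := ⟨w, hw, rfl⟩
  have h2 : ContMDiffAt 𝓘(ℝ, Euc n) 𝓘(ℝ, Euc k) ∞ (fun x : O => F x) ⟨w.1, hwO⟩ := by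
    have h3 := h1 ⟨w.1, hwO⟩
    convert h3 using 1
    funext x
    exact dif_pos (hOW x.2)
  rw [contMDiffAt_subtype_iff, contMDiffAt_iff_contDiffAt] at h2
  obtain ⟨C, t, ht, hC⟩ := (h2.of_le (by exact_mod_cast le_top) :
    ContDiffAt ℝ 1 F w.1).exists_lipschitzOnWith
  refine ⟨C, C.2, Subtype.val ⁻¹' t, continuousAt_subtype_val.preimage_mem_nhds ht, ?_⟩
  intro a ha b hb
  have h4 := hC.norm_sub_le ha hb
  have hFa : F a.1 = φ a := dif_pos a.2
  have hFb : F b.1 = φ b := dif_pos b.2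
  rwa [hFa, hFb] at h4

theorem tendsto_of_pow {n : ℕ} {c : ℝ → Euc n} {k : ℕ}
    (h : (fun t => ‖c t - c 0‖ ^ k) =o[𝓝 0] (fun t : ℝ => t)) : Tendsto c (𝓝 0) (𝓝 (c 0)) := by
  have h1 : Tendsto (fun t => ‖c t - c 0‖ ^ k) (𝓝 0) (𝓝 0) := h.trans_tendsto tendsto_id
  have hk : k ≠ 0 := by
    rintro rfl
    simp at h1
  rw [tendsto_iff_norm_sub_tendsto_zero]
  have h2 := h1.rpow_const (p := (k : ℝ)⁻¹) (Or.inr (by positivity))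
  rw [Real.zero_rpow (by simpa using hk)] at h2
  refine h2.congr fun t => ?_
  exact Real.pow_rpow_inv_natCast (norm_nonneg _) hk

theorem nhds_ofOpen {n : ℕ} (W : Opens (Euc n)) (w : W) :
    𝓝 w ≤ @nhds _ (ofOpen W).topology w := by
  have : (inferInstance : TopologicalSpace W) ≤ (ofOpen W).topology := by
    intro s hs
    exact hs (d := (id : W → W)) contMDiff_id
  exact nhds_mono this

theorem tendsto_ofOpen {n : ℕ} {W : Opens (Euc n)} {c : ℝ → W} {w : W}
    (h : Tendsto (fun t => (c t).1) (𝓝 0) (𝓝 w.1)) : Tendsto c (𝓝 0) (𝓝 w) :=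
  tendsto_subtype_rng.2 h

theorem isNilpotentPath_ofOpen {n : ℕ} {W : Opens (Euc n)} {c : ℝ → W} {k : ℕ}
    (h : (fun t => ‖(c t).1 - (c 0).1‖ ^ k) =o[𝓝 0] (fun t : ℝ => t)) :
    (ofOpen W).IsNilpotentPath c := by
  have h0 : Tendsto c (𝓝 0) (𝓝 (c 0)) := tendsto_ofOpen (tendsto_of_pow (c := fun t => (c t).1) h)
  refine ⟨h0.trans (nhds_ofOpen W _), fun U m K φ hφ hU => ⟨k, ?_⟩⟩
  obtain ⟨C, hC0, N, hN, hC⟩ := lipschitz_observable hφ hU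
  refine IsBigO.trans_isLittleO (IsBigO.of_bound (C ^ k) ?_) h
  filter_upwards [h0 hN] with t ht
  have := hC _ ht _ (mem_of_mem_nhds hN)
  rw [Real.norm_of_nonneg (by positivity), Real.norm_of_nonneg (by positivity), ← mul_pow]
  exact pow_le_pow_left₀ (norm_nonneg _) this k

theorem eq_zero_of_isLittleO {n : ℕ} {c : ℝ → Euc n} (h : c =o[𝓝 0] (fun t : ℝ => t)) :
    c 0 = 0 := by
  have := (h.def one_pos).self_of_nhds
  simpa using this

theorem pathEq_ofOpen {n : ℕ} {W : Opens (Euc n)} {c c' : ℝ → W}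
    (h0 : Tendsto (fun t => (c t).1) (𝓝 0) (𝓝 (c 0).1))
    (h : (fun t => (c t).1 - (c' t).1) =o[𝓝 0] (fun t : ℝ => t)) : (ofOpen W).PathEq c c' := by
  have e0 : c 0 = c' 0 := Subtype.ext (sub_eq_zero.1 (eq_zero_of_isLittleO h))
  have h0' : Tendsto (fun t => (c' t).1) (𝓝 0) (𝓝 (c' 0).1) := by
    have h1 : Tendsto (fun t => (c t).1 - (c' t).1) (𝓝 0) (𝓝 0) := h.trans_tendsto tendsto_id
    simpa [e0] using h0.sub h1
  intro U k K φ hφ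
  refine ⟨by rw [e0], fun hU => ?_⟩
  obtain ⟨C, hC0, N, hN, hC⟩ := lipschitz_observable hφ hU
  refine IsBigO.trans_isLittleO (IsBigO.of_bound C ?_) h
  filter_upwards [tendsto_ofOpen h0 hN, tendsto_ofOpen h0' (e0 ▸ hN)] with t ht ht'
  exact hC _ ht _ ht'

theorem IsNilpotentPath.exists_pow {n : ℕ} {c : ℝ → Euc n} (h : (euc n).IsNilpotentPath c) :
    ∃ k : ℕ, (fun t => ‖c t - c 0‖ ^ k) =o[𝓝 0] (fun t : ℝ => t) :=
  h.2 univ ⊤ (fun x => x) (isObservable_euc_id n) (mem_univ _)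

theorem isNilpotentPath_euc {n : ℕ} {c : ℝ → Euc n} {k : ℕ}
    (h : (fun t => ‖c t - c 0‖ ^ k) =o[𝓝 0] (fun t : ℝ => t)) : (euc n).IsNilpotentPath c :=
  (isNilpotentPath_ofOpen (W := ⊤) (c := fun t => ⟨c t, trivial⟩) h).map (incl ⊤)

theorem PathEq.sub_isLittleO {n : ℕ} {c c' : ℝ → Euc n} (h : (euc n).PathEq c c') :
    (fun t => c t - c' t) =o[𝓝 0] (fun t : ℝ => t) :=
  (h univ ⊤ (fun x => x) (isObservable_euc_id n)).2 (mem_univ _)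

theorem pathEq_euc {n : ℕ} {c c' : ℝ → Euc n} (h0 : Tendsto c (𝓝 0) (𝓝 (c 0)))
    (h : (fun t => c t - c' t) =o[𝓝 0] (fun t : ℝ => t)) : (euc n).PathEq c c' :=
  PathEq.map (incl ⊤) (pathEq_ofOpen (W := ⊤) (c := fun t => ⟨c t, trivial⟩)
    (c' := fun t => ⟨c' t, trivial⟩) h0 h)

/-- The standard part of an extended point of `ℝⁿ`: evaluation of a representative at `0`. -/
def st {n : ℕ} (x : Ext (euc n)) : Euc n :=
  Quotient.lift (fun c : {c : ℝ → Euc n // (euc n).IsNilpotentPath c} => c.1 0)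
    (fun _ _ h => sub_eq_zero.1 (eq_zero_of_isLittleO (PathEq.sub_isLittleO h))) x

theorem Represents.st_eq {n : ℕ} {c : ℝ → Euc n} {x : Ext (euc n)} (h : Represents c x) :
    st x = c 0 := by
  obtain ⟨hc, rfl⟩ := h
  rfl

theorem st_hat {n : ℕ} (x : Euc n) : st (hat (X := euc n) x) = x := rfl

/-- The subset `•V ⊆ •ℝⁿ` of an open set `V ⊆ ℝⁿ`: the image of `•V` under the extension of the
inclusion. -/
def extOpen {n : ℕ} (V : Opens (Euc n)) : Set (Ext (euc n)) := range (Ext.map (incl V))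

theorem exists_lift {n : ℕ} {V : Opens (Euc n)} {x : Ext (euc n)} (hx : st x ∈ V) {c : ℝ → Euc n}
    (hc : Represents c x) : ∃ (c' : ℝ → V) (z : Ext (ofOpen V)), Represents c' z ∧
      Ext.map (incl V) z = x ∧ ∀ᶠ t in 𝓝 0, (c' t).1 = c t := by
  classical
  rw [hc.st_eq] at hx
  obtain ⟨k, hk⟩ := hc.1.exists_pow
  have h0 := tendsto_of_pow hk
  let c' : ℝ → V := fun t => if h : c t ∈ V then ⟨c t, h⟩ else ⟨c 0, hx⟩
  have hev : ∀ᶠ t in 𝓝 0, (c' t).1 = c t := by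
    filter_upwards [h0 (V.isOpen.mem_nhds hx)] with t ht
    have ht' : c t ∈ V := ht
    simp [c', ht']
  have hz : (c' 0).1 = c 0 := hev.self_of_nhds
  have hnil : (ofOpen V).IsNilpotentPath c' := by
    refine isNilpotentPath_ofOpen (k := k) (hk.congr' ?_ EventuallyEq.rfl)
    filter_upwards [hev] with t ht
    rw [ht, hz]
  have hr : Represents c' (Quotient.mk (ofOpen V).pathSetoid ⟨c', hnil⟩ : Ext (ofOpen V)) :=
    ⟨hnil, rfl⟩
  refine ⟨c', _, hr, ?_, hev⟩
  refine (hr.map (incl V)).eq hc (PathEq.symm (pathEq_euc h0 ?_))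
  refine (isLittleO_zero (fun t : ℝ => t) (𝓝 0)).congr' ?_ EventuallyEq.rfl
  filter_upwards [hev] with t ht
  exact (sub_eq_zero.2 ht.symm).symm

theorem mem_extOpen_iff {n : ℕ} {V : Opens (Euc n)} {x : Ext (euc n)} :
    x ∈ extOpen V ↔ st x ∈ V := by
  constructor
  · rintro ⟨z, rfl⟩
    obtain ⟨c, hc⟩ := exists_represents z
    rw [(hc.map (incl V)).st_eq]
    exact (c 0).2
  · intro hx
    obtain ⟨c, hc⟩ := exists_represents x
    obtain ⟨_, z, _, hz, _⟩ := exists_lift hx hc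
    exact ⟨z, hz⟩

theorem represents_of_eventuallyEq {n : ℕ} {c c' : ℝ → Euc n} {x : Ext (euc n)}
    (h : Represents c x) (he : ∀ᶠ t in 𝓝 0, c' t = c t) : Represents c' x := by
  obtain ⟨k, hk⟩ := h.1.exists_pow
  refine h.of_pathEq (isNilpotentPath_euc (k := k) (hk.congr' ?_ EventuallyEq.rfl))
    (pathEq_euc (tendsto_of_pow hk) ?_)
  · filter_upwards [he] with t ht
    rw [ht, he.self_of_nhds]
  · refine (isLittleO_zero (fun t : ℝ => t) (𝓝 0)).congr' ?_ EventuallyEq.rfl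
    filter_upwards [he] with t ht
    exact (sub_eq_zero.2 ht.symm).symm

end CInfSpace

open CInfSpace

/-! ### First order infinitesimals -/

/-- The set `D ⊆ •ℝ` of first order infinitesimals: `h(t) = O(t)` for `t → 0`. -/
def firstOrder : Set (Ext CInfSpace.real) :=
  {h | ∃ c : ℝ → ℝ, Represents (X := CInfSpace.real) c h ∧ c =O[𝓝 0] (fun t : ℝ => t)}

/-! ## The category of types of extended figures -/

/-- An object of the category `S•ℝ^∞`: a subset of some `•ℝⁿ`. -/
structure ExtType where
  dim : ℕ
  carrier : Set (Ext (euc dim))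

instance : CoeSort ExtType Type := ⟨fun S => S.carrier⟩

namespace ExtType

/-- The open subset of `S` defined by the open set `V ⊆ ℝⁿ`, i.e. `•V ∩ S`, as an object of
`S•ℝ^∞`. Every open set of the topology of `S` is of this form. -/
def inter (S : ExtType) (V : Opens (Euc S.dim)) : ExtType := ⟨S.dim, S.carrier ∩ extOpen V⟩

/-- The inclusion `•V ∩ S → S`. -/
def interIncl (S : ExtType) (V : Opens (Euc S.dim)) (x : S.inter V) : S := ⟨x.1, x.2.1⟩

/-- Arrows `S → T` of `S•ℝ^∞`: maps that locally are of the form `f(x) = •g⟨p, x⟩` for an extended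
parameter `p ∈ •U ⊆ •ℝ^q` and an ordinary smooth map `g : U × V → ℝᵗ`. The value `•g⟨p, x⟩` is the
class of `t ↦ g (P t, ξ t)`, where `P` and `ξ` are any paths representing `p` and `x` (these lie in
`U` and `V` for small `t`; the values of `g` off `U × V` are irrelevant). -/
def IsArrow (S T : ExtType) (f : S → T) : Prop :=
  ∀ s : S, ∃ (q : ℕ) (p : Ext (euc q)) (U : Opens (Euc q)) (V : Opens (Euc S.dim))
    (g : Euc q × Euc S.dim → Euc T.dim),
    p ∈ extOpen U ∧ s.1 ∈ extOpen V ∧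
    ContDiffOn ℝ ∞ g ((U : Set (Euc q)) ×ˢ (V : Set (Euc S.dim))) ∧
    ∀ x : S, x.1 ∈ extOpen V → ∀ (P : ℝ → Euc q) (ξ : ℝ → Euc S.dim),
      Represents (X := euc q) P p → Represents (X := euc S.dim) ξ x.1 →
        Represents (X := euc T.dim) (fun t => g (P t, ξ t)) (f x).1

theorem isArrow_of_val {S : ExtType} {A B : Set (Ext (euc S.dim))} {f : A → B}
    (h : ∀ x, (f x).1 = x.1) : IsArrow ⟨S.dim, A⟩ ⟨S.dim, B⟩ f := by
  intro s
  refine ⟨0, hat (X := euc 0) 0, ⊤, ⊤, Prod.snd, mem_extOpen_iff.2 trivial,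
    mem_extOpen_iff.2 trivial, contDiff_snd.contDiffOn, ?_⟩
  intro x _ P ξ _ hξ
  rw [h x]
  exact hξ

theorem isArrow_id (S : ExtType) : IsArrow S S (fun x => x) :=
  isArrow_of_val (S := S) fun _ => rfl

theorem isArrow_const (S T : ExtType) (y : T) : IsArrow S T (fun _ => y) := by
  intro s
  refine ⟨T.dim, y.1, ⊤, ⊤, Prod.fst, mem_extOpen_iff.2 trivial,
    mem_extOpen_iff.2 trivial, contDiff_fst.contDiffOn, ?_⟩
  intro x _ P ξ hP _
  exact hP

theorem IsArrow.continuous {S T : ExtType} {f : S → T} (hf : IsArrow S T f)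
    (W : Opens (Euc T.dim)) (s : S) (hs : (f s).1 ∈ extOpen W) :
    ∃ V : Opens (Euc S.dim), s.1 ∈ extOpen V ∧
      ∀ x : S, x.1 ∈ extOpen V → (f x).1 ∈ extOpen W := by
  obtain ⟨q, p, U, V, g, hp, hsV, hg, h⟩ := hf s
  obtain ⟨P, hP⟩ := exists_represents p
  have hUV : IsOpen ((U : Set (Euc q)) ×ˢ (V : Set (Euc S.dim))) := U.isOpen.prod V.isOpen
  have hst : ∀ x : S, x.1 ∈ extOpen V → st (f x).1 = g (st p, st x.1) := by
    intro x hx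
    obtain ⟨ξ, hξ⟩ := exists_represents x.1
    rw [(h x hx P ξ hP hξ).st_eq, hP.st_eq, hξ.st_eq]
  have hO := hg.continuousOn.isOpen_inter_preimage hUV W.isOpen
  have hO' : IsOpen ((fun y : Euc S.dim => (st p, y)) ⁻¹'
      (((U : Set (Euc q)) ×ˢ (V : Set (Euc S.dim))) ∩ g ⁻¹' W)) := hO.preimage (by fun_prop)
  refine ⟨⟨_, hO'⟩, ?_, ?_⟩
  · rw [mem_extOpen_iff] at hs ⊢
    refine ⟨⟨mem_extOpen_iff.1 hp, mem_extOpen_iff.1 hsV⟩, ?_⟩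
    rw [mem_preimage, ← hst s hsV]
    exact hs
  · intro x hx
    rw [mem_extOpen_iff] at hx ⊢
    have hxV : x.1 ∈ extOpen V := mem_extOpen_iff.2 hx.1.2
    rw [hst x hxV]
    exact hx.2

theorem pair_nilpotent {m n : ℕ} {c : ℝ → Euc m} {d : ℝ → Euc n}
    (hc : (euc m).IsNilpotentPath c) (hd : (euc n).IsNilpotentPath d) :
    (euc (m + n)).IsNilpotentPath
      (fun t => EuclideanSpace.finAddEquivProd (𝕜 := ℝ).symm (c t, d t)) := by
  obtain ⟨j, hj⟩ := hc.exists_pow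
  obtain ⟨k, hk⟩ := hd.exists_pow
  have hc0 := tendsto_of_pow hj
  have hd0 := tendsto_of_pow hk
  let L : Euc m × Euc n →L[ℝ] Euc (m + n) :=
    ((EuclideanSpace.finAddEquivProd (𝕜 := ℝ) (n := m) (m := n)).symm :)
  change (euc (m + n)).IsNilpotentPath (fun t => L (c t, d t))
  have hc1 : ∀ᶠ t in 𝓝 (0 : ℝ), ‖c t - c 0‖ ≤ 1 := by
    have := tendsto_iff_norm_sub_tendsto_zero.1 hc0
    exact (this.eventually (ge_mem_nhds one_pos))
  have hd1 : ∀ᶠ t in 𝓝 (0 : ℝ), ‖d t - d 0‖ ≤ 1 := by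
    have := tendsto_iff_norm_sub_tendsto_zero.1 hd0
    exact (this.eventually (ge_mem_nhds one_pos))
  refine isNilpotentPath_euc (k := j + k) ?_
  have hsum := hj.norm_left.add hk.norm_left
  refine IsBigO.trans_isLittleO (IsBigO.of_bound (‖L‖ ^ (j + k)) ?_) hsum
  filter_upwards [hc1, hd1] with t h1 h2
  rw [Real.norm_of_nonneg (by positivity), Real.norm_of_nonneg (by positivity),
    Real.norm_of_nonneg (by positivity), Real.norm_of_nonneg (by positivity)]
  have hb : ‖L (c t, d t) - L (c 0, d 0)‖ ≤
      ‖L‖ * max ‖c t - c 0‖ ‖d t - d 0‖ := by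
    rw [← map_sub]
    exact L.le_opNorm _
  calc ‖L (c t, d t) - L (c 0, d 0)‖ ^ (j + k)
      ≤ (‖L‖ * max ‖c t - c 0‖ ‖d t - d 0‖) ^ (j + k) :=
        pow_le_pow_left₀ (norm_nonneg _) hb _
    _ = ‖L‖ ^ (j + k) * max ‖c t - c 0‖ ‖d t - d 0‖ ^ (j + k) := mul_pow _ _ _
    _ ≤ _ := by
        refine mul_le_mul_of_nonneg_left ?_ (by positivity)
        rcases max_choice ‖c t - c 0‖ ‖d t - d 0‖ with h | h <;> rw [h]
        · exact (pow_le_pow_of_le_one (norm_nonneg _) h1 (Nat.le_add_right j k)).trans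
            (le_add_of_nonneg_right (by positivity))
        · exact (pow_le_pow_of_le_one (norm_nonneg _) h2 (Nat.le_add_left k j)).trans
            (le_add_of_nonneg_left (by positivity))

theorem IsArrow.comp {S T R : ExtType} {f : S → T} {f' : T → R} (hf : IsArrow S T f)
    (hf' : IsArrow T R f') : IsArrow S R (fun x => f' (f x)) := by
  intro s
  obtain ⟨q', p', U', V', g', hp', hs', hg', h'⟩ := hf' (f s)
  obtain ⟨V₁, hsV₁, hV₁⟩ := hf.continuous V' s hs'
  obtain ⟨q, p, U, V, g, hp, hs, hg, h⟩ := hf s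
  obtain ⟨P', hP'⟩ := exists_represents p'
  obtain ⟨P, hP⟩ := exists_represents p
  obtain ⟨ξ, hξ⟩ := exists_represents s.1
  obtain ⟨L, Z, hZ, hLZ⟩ : ∃ (L : Euc (q' + q) →L[ℝ] Euc q' × Euc q) (Z : ℝ → Euc (q' + q)),
      (euc (q' + q)).IsNilpotentPath Z ∧ ∀ t, L (Z t) = (P' t, P t) :=
    ⟨(EuclideanSpace.finAddEquivProd (𝕜 := ℝ) (n := q') (m := q) :), _,
      pair_nilpotent hP'.1 hP.1, fun t => ContinuousLinearEquiv.apply_symm_apply _ _⟩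
  let z : Ext (euc (q' + q)) := Quotient.mk (euc (q' + q)).pathSetoid ⟨Z, hZ⟩
  have hz : Represents (X := euc (q' + q)) Z z := ⟨hZ, rfl⟩
  let G : Euc (q' + q) × Euc S.dim → Euc R.dim :=
    fun y => g' ((L y.1).1, g ((L y.1).2, y.2))
  let A : Set (Euc (q' + q) × Euc S.dim) :=
    {y | (L y.1).2 ∈ U ∧ y.2 ∈ V}
  have hA : IsOpen A := by
    refine (U.isOpen.preimage ?_).inter (V.isOpen.preimage ?_)
    · fun_prop
    · fun_prop
  let g₁ : Euc (q' + q) × Euc S.dim → Euc T.dim := fun y => g ((L y.1).2, y.2)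
  have hg₁ : ContDiffOn ℝ ∞ g₁ A := by
    refine hg.comp (f := fun y : Euc (q' + q) × Euc S.dim => ((L y.1).2, y.2)) ?_ ?_
    · exact ContDiff.contDiffOn (by fun_prop)
    · exact fun y hy => ⟨hy.1, hy.2⟩
  let B : Set (Euc (q' + q) × Euc S.dim) :=
    (A ∩ g₁ ⁻¹' V') ∩ {y | (L y.1).1 ∈ U'}
  have hB : IsOpen B := by
    refine (hg₁.continuousOn.isOpen_inter_preimage hA V'.isOpen).inter (U'.isOpen.preimage ?_)
    fun_prop
  have hG : ContDiffOn ℝ ∞ G B := by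
    refine hg'.comp (f := fun y => ((L y.1).1, g₁ y)) ?_ ?_
    · exact ContDiffOn.prodMk (ContDiff.contDiffOn (by fun_prop))
        (hg₁.mono fun y hy => hy.1.1)
    · exact fun y hy => ⟨hy.2, hy.1.2⟩
  have hstf : st (f s).1 = g (P 0, ξ 0) := (h s hs P ξ hP hξ).st_eq
  have hLz : L (Z 0) = (P' 0, P 0) := hLZ 0
  have hmem : (st z, st s.1) ∈ B := by
    rw [hz.st_eq, hξ.st_eq]
    refine ⟨⟨⟨?_, ?_⟩, ?_⟩, ?_⟩
    · change (L (Z 0)).2 ∈ U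
      rw [hLz, ← hP.st_eq]
      exact mem_extOpen_iff.1 hp
    · rw [← hξ.st_eq]
      exact mem_extOpen_iff.1 hs
    · change g ((L (Z 0)).2, ξ 0) ∈ V'
      rw [hLz, ← hstf]
      exact mem_extOpen_iff.1 hs'
    · change (L (Z 0)).1 ∈ U'
      rw [hLz, ← hP'.st_eq]
      exact mem_extOpen_iff.1 hp'
  obtain ⟨U₂, V₂, hU₂, hV₂, hzU₂, hsV₂, hsub⟩ := isOpen_prod_iff.1 hB _ _ hmem
  refine ⟨q' + q, z, ⟨U₂, hU₂⟩, ⟨V₂, hV₂⟩ ⊓ V ⊓ V₁, G, mem_extOpen_iff.2 hzU₂,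
    mem_extOpen_iff.2 ⟨⟨hsV₂, mem_extOpen_iff.1 hs⟩, mem_extOpen_iff.1 hsV₁⟩, ?_, ?_⟩
  · exact hG.mono fun y hy => hsub ⟨hy.1, hy.2.1.1⟩
  · intro x hx Q η hQ hη
    have hx' := mem_extOpen_iff.1 hx
    have hxV : x.1 ∈ extOpen V := mem_extOpen_iff.2 hx'.1.2
    have hxV' : (f x).1 ∈ extOpen V' := hV₁ x (mem_extOpen_iff.2 hx'.2)
    let π₁ : Hom (euc (q' + q)) (euc q') :=
      Hom.ofContMDiff (fun y : Euc (q' + q) => (L y).1)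
        (contMDiff_iff_contDiff.2 (by fun_prop))
    let π₂ : Hom (euc (q' + q)) (euc q) :=
      Hom.ofContMDiff (fun y : Euc (q' + q) => (L y).2)
        (contMDiff_iff_contDiff.2 (by fun_prop))
    have e1 : (fun t => π₁ (Z t)) = P' := by
      funext t
      exact congrArg Prod.fst (hLZ t)
    have e2 : (fun t => π₂ (Z t)) = P := by
      funext t
      exact congrArg Prod.snd (hLZ t)
    have hQ1 : Represents (X := euc q') (fun t => (L (Q t)).1) p' := by
      refine hP'.of_pathEq (hQ.1.map π₁) ?_
      rw [← e1]
      exact PathEq.map π₁ (hz.pathEq hQ)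
    have hQ2 : Represents (X := euc q) (fun t => (L (Q t)).2) p := by
      refine hP.of_pathEq (hQ.1.map π₂) ?_
      rw [← e2]
      exact PathEq.map π₂ (hz.pathEq hQ)
    exact h' (f x) hxV' _ _ hQ1 (h x hxV _ _ hQ2 hη)

/-- The set of standard points of an open set `U ⊆ ℝⁿ`, as an object of `S•ℝ^∞`. -/
def std {n : ℕ} (U : Opens (Euc n)) : ExtType := ⟨n, (hat (X := euc n)) '' (U : Set (Euc n))⟩

/-- The standard points of `U` are in bijection with `U`. -/
def ofStd {n : ℕ} {U : Opens (Euc n)} (x : std U) : U :=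
  ⟨st (n := n) x.1, by obtain ⟨_, ⟨u, hu, rfl⟩⟩ := x; exact hu⟩

/-- The standard points of `U` are in bijection with `U`. -/
def toStd {n : ℕ} {U : Opens (Euc n)} (u : U) : std U := ⟨hat (X := euc n) u.1, u.1, u.2, rfl⟩

theorem toStd_ofStd {n : ℕ} {U : Opens (Euc n)} (x : std U) : toStd (ofStd x) = x := by
  obtain ⟨_, ⟨u, hu, rfl⟩⟩ := x
  rfl

theorem ofStd_toStd {n : ℕ} {U : Opens (Euc n)} (u : U) : ofStd (toStd u) = u := rfl

theorem isArrow_std {m n : ℕ} {U : Opens (Euc m)} {V : Opens (Euc n)} {f : U → V}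
    (hf : ContMDiff 𝓘(ℝ, Euc m) 𝓘(ℝ, Euc n) ∞ f) :
    IsArrow (std U) (std V) (fun x => toStd (f (ofStd x))) := by
  classical
  intro s
  let F : Euc m → Euc n := fun x => if hx : x ∈ U then (f ⟨x, hx⟩).1 else 0
  have hFf : ∀ x : U, F x.1 = (f x).1 := fun x => dif_pos x.2
  have hF : ContDiffOn ℝ ∞ F U := by
    intro x hx
    have h1 : ContMDiffAt 𝓘(ℝ, Euc m) 𝓘(ℝ, Euc n) ∞ (fun y : U => F y) ⟨x, hx⟩ := by
      have h2 := (ContMDiff.subtypeVal_comp_iff V f).2 hf ⟨x, hx⟩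
      convert h2 using 1
      funext y
      exact hFf y
    rw [contMDiffAt_subtype_iff, contMDiffAt_iff_contDiffAt] at h1
    exact h1.contDiffWithinAt
  refine ⟨0, hat (X := euc 0) 0, ⊤, U, fun y => F y.2, mem_extOpen_iff.2 trivial,
    mem_extOpen_iff.2 (ofStd s).2, ?_, ?_⟩
  · exact hF.comp contDiff_snd.contDiffOn fun y hy => hy.2
  · intro x hx P ξ _ hξ
    obtain ⟨c, z, hc, hz, hev⟩ := exists_lift (mem_extOpen_iff.1 hx) hξ
    have hx' : x = toStd (ofStd x) := (toStd_ofStd x).symm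
    have hpe : (ofOpen U).PathEq c (fun _ => ofStd x) := by
      have h1 : Represents (X := euc m) (fun t => (c t).1) x.1 := hz ▸ hc.map (incl U)
      have h2 : Represents (X := euc m) (fun _ => (ofStd x).1) x.1 := by
        rw [hx']
        exact represents_hat (X := euc m) (ofStd x).1
      have h3 := h1.pathEq h2
      obtain ⟨k, hk⟩ := h1.1.exists_pow
      exact pathEq_ofOpen (tendsto_of_pow hk) h3.sub_isLittleO
    let fh : Hom (ofOpen U) (euc n) := (Hom.ofContMDiff f hf : Hom (ofOpen U) (ofOpen V)).comp (incl V)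
    have h4 : Represents (X := euc n) (fun t => fh (c t)) (toStd (f (ofStd x))).1 :=
      (represents_hat (X := euc n) (f (ofStd x)).1).of_pathEq (hc.1.map fh)
        (PathEq.map fh hpe).symm
    refine represents_of_eventuallyEq h4 ?_
    filter_upwards [hev] with t ht
    rw [← ht]
    exact hFf (c t)

end ExtType

/-! ## The category `•C^∞` of extended spaces -/

/-- An object of the category `•C^∞`: a set together with, for every `S` in `S•ℝ^∞`, a set of
figures `S → X`, closed under reparametrisation, containing the constant maps, and satisfying the
sheaf condition. -/
structure ExtSpace : Type (u + 1) where
  carrier : Type u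
  IsFig : ∀ S : ExtType, (S → carrier) → Prop
  fig_comp : ∀ {S T : ExtType} {d : T → carrier} {f : S → T},
    IsFig T d → ExtType.IsArrow S T f → IsFig S (fun x => d (f x))
  fig_const : ∀ (S : ExtType) (x : carrier), IsFig S (fun _ => x)
  fig_local : ∀ {S : ExtType} {d : S → carrier},
    (∀ s : S, ∃ V : Opens (Euc S.dim), s.1 ∈ extOpen V ∧
      IsFig (S.inter V) (fun x => d (S.interIncl V x))) → IsFig S d

instance : CoeSort ExtSpace.{u} (Type u) := ⟨ExtSpace.carrier⟩

namespace ExtSpace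

open ExtType

/-- A map is an arrow of `•C^∞` iff it takes figures to figures. -/
def IsHom (X : ExtSpace.{u}) (Y : ExtSpace.{v}) (f : X → Y) : Prop :=
  ∀ ⦃S : ExtType⦄ ⦃d : S → X⦄, X.IsFig S d → Y.IsFig S (fun x => f (d x))

/-- Arrows of `•C^∞`. -/
@[ext]
structure Hom (X : ExtSpace.{u}) (Y : ExtSpace.{v}) where
  toFun : X → Y
  isHom : IsHom X Y toFun

instance (X : ExtSpace.{u}) (Y : ExtSpace.{v}) : CoeFun (Hom X Y) (fun _ => X → Y) :=
  ⟨Hom.toFun⟩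

theorem isArrow_interIncl (S : ExtType) (V : Opens (Euc S.dim)) :
    IsArrow (S.inter V) S (S.interIncl V) :=
  isArrow_of_val (S := S) fun _ => rfl

/-- The extended space `S̄` represented by an object `S` of `S•ℝ^∞`. -/
def ofType (T : ExtType) : ExtSpace.{0} where
  carrier := T
  IsFig S f := IsArrow S T f
  fig_comp hd hf := hf.comp hd
  fig_const S x := isArrow_const S T x
  fig_local {S d} h := by
    intro s
    obtain ⟨V, hs, hd⟩ := h s
    obtain ⟨q, p, U, V', g, hp, hsV', hg, hh⟩ := hd ⟨s.1, s.2, hs⟩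
    refine ⟨q, p, U, (V' ⊓ V : Opens (Euc S.dim)), g, hp,
      mem_extOpen_iff.2 ⟨mem_extOpen_iff.1 hsV', mem_extOpen_iff.1 hs⟩,
      hg.mono (prod_mono subset_rfl inter_subset_left), ?_⟩
    intro x hx P ξ hP hξ
    have hx' := mem_extOpen_iff.1 hx
    exact hh ⟨x.1, x.2, mem_extOpen_iff.2 hx'.2⟩ (mem_extOpen_iff.2 hx'.1) P ξ hP hξ

/-- The product of extended spaces. -/
def prod (X : ExtSpace.{u}) (Y : ExtSpace.{v}) : ExtSpace.{max u v} where
  carrier := X × Y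
  IsFig S d := X.IsFig S (fun x => (d x).1) ∧ Y.IsFig S (fun x => (d x).2)
  fig_comp hd hf := ⟨X.fig_comp hd.1 hf, Y.fig_comp hd.2 hf⟩
  fig_const S x := ⟨X.fig_const S x.1, Y.fig_const S x.2⟩
  fig_local h := ⟨X.fig_local fun s => (h s).imp fun _ hV => ⟨hV.1, hV.2.1⟩,
    Y.fig_local fun s => (h s).imp fun _ hV => ⟨hV.1, hV.2.2⟩⟩

/-- The exponential object `Y^X`: a map `d : S → •C^∞(X, Y)` is a figure iff
`(s, x) ↦ d(s)(x)` is an arrow `S̄ × X → Y`. -/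
def exp (Y : ExtSpace.{u}) (X : ExtSpace.{v}) : ExtSpace.{max u v} where
  carrier := Hom X Y
  IsFig S d := IsHom ((ofType S).prod X) Y (fun z => d z.1 z.2)
  fig_comp {S T d f} hd hf := by
    intro R e he
    exact hd (d := fun x => (f (e x).1, (e x).2)) ⟨he.1.comp hf, he.2⟩
  fig_const S x := fun _ _ he => x.isHom he.2
  fig_local {S d} h := by
    intro R e he
    refine Y.fig_local fun r => ?_
    obtain ⟨V, hV, hd⟩ := h (e r).1
    obtain ⟨W, hW, hWV⟩ := IsArrow.continuous he.1 V r hV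
    refine ⟨W, hW, ?_⟩
    have h1 : IsArrow (R.inter W) S (fun x => (e (R.interIncl W x)).1) :=
      (isArrow_interIncl R W).comp he.1
    have h2 : IsArrow (R.inter W) (S.inter V)
        (fun x => ⟨(e (R.interIncl W x)).1.1, (e (R.interIncl W x)).1.2, hWV _ x.2.2⟩) := h1
    exact hd (d := fun x => (⟨(e (R.interIncl W x)).1.1, (e (R.interIncl W x)).1.2, hWV _ x.2.2⟩,
      (e (R.interIncl W x)).2)) ⟨h2, X.fig_comp he.2 (isArrow_interIncl R W)⟩

/-- The extended space generated by a family `D₀` of maps that contains the constant maps: figures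
are locally compositions of an arrow of `S•ℝ^∞` with a map of the family. -/
def generate (Z : Type u) (D₀ : ∀ T : ExtType, (T → Z) → Prop)
    (hconst : ∀ (T : ExtType) (z : Z), D₀ T (fun _ => z)) : ExtSpace.{u} where
  carrier := Z
  IsFig S δ := ∀ s : S, ∃ V : Opens (Euc S.dim), s.1 ∈ extOpen V ∧
    ∃ (T : ExtType) (d : T → Z) (f : S.inter V → T), D₀ T d ∧ IsArrow (S.inter V) T f ∧
      ∀ x, δ (S.interIncl V x) = d (f x)
  fig_comp {S T δ f} hδ hf := by
    intro s
    obtain ⟨V, hV, R, d, e, hd, he, hδ'⟩ := hδ (f s)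
    obtain ⟨W, hW, hWV⟩ := hf.continuous V s hV
    have h1 : IsArrow (S.inter W) T (fun x => f (S.interIncl W x)) :=
      (isArrow_interIncl S W).comp hf
    have h2 : IsArrow (S.inter W) (T.inter V)
        (fun x => ⟨(f (S.interIncl W x)).1, (f (S.interIncl W x)).2, hWV _ x.2.2⟩) := h1
    exact ⟨W, hW, R, d, _, hd, h2.comp he, fun x => hδ' ⟨(f (S.interIncl W x)).1, (f (S.interIncl W x)).2, hWV _ x.2.2⟩⟩
  fig_const S z := fun s => ⟨⊤, mem_extOpen_iff.2 trivial, S.inter ⊤, fun _ => z, fun x => x,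
    hconst _ z, isArrow_id _, fun _ => rfl⟩
  fig_local {S δ} h := by
    intro s
    obtain ⟨V, hV, h1⟩ := h s
    obtain ⟨W, hW, R, d, e, hd, he, h2⟩ := h1 ⟨s.1, s.2, hV⟩
    have hsplit : ∀ x : S.inter (W ⊓ V : Opens (Euc S.dim)), st (n := S.dim) x.1 ∈ W ∧
        st (n := S.dim) x.1 ∈ V := fun x => mem_extOpen_iff.1 x.2.2
    have h3 : IsArrow (S.inter (W ⊓ V : Opens (Euc S.dim))) ((S.inter V).inter W)
        (fun x => ⟨x.1, ⟨x.2.1, mem_extOpen_iff.2 (hsplit x).2⟩, mem_extOpen_iff.2 (hsplit x).1⟩) :=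
      isArrow_of_val (S := S) fun _ => rfl
    exact ⟨(W ⊓ V : Opens (Euc S.dim)),
      mem_extOpen_iff.2 ⟨mem_extOpen_iff.1 hW, mem_extOpen_iff.1 hV⟩,
      R, d, _, hd, h3.comp he, fun x =>
        h2 ⟨x.1, ⟨x.2.1, mem_extOpen_iff.2 (hsplit x).2⟩, mem_extOpen_iff.2 (hsplit x).1⟩⟩

/-- The generating figures `d : T → Z` of the extended space on a subset `Z ⊆ •X`: constant maps, and
restrictions `•h|_T` of extensions of figures `h : V → X` of `X` with `T ⊆ •V`. -/
def IsGenFig (X : CInfSpace.{u}) (Z : Set (Ext X)) (T : ExtType) (d : T → Z) : Prop :=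
  (∃ z : Z, ∀ x, d x = z) ∨
    ∃ (V : Opens (Euc T.dim)) (h : V → X) (hh : X.IsFig V h),
      ∀ x : T, ∃ y : Ext (ofOpen V), Ext.map (incl V) y = x.1 ∧
        (d x).1 = Ext.map (X.homOfFig h hh) y

/-- The extended space `•(Z X)` induced on a subset `Z` of `•X` by `X`. -/
def induced (X : CInfSpace.{u}) (Z : Set (Ext X)) : ExtSpace.{u} :=
  generate Z (IsGenFig X Z) (fun _ z => Or.inl ⟨z, fun _ => rfl⟩)

/-- The extension `•X` of a `C^∞` space as an extended space. -/
def ext (X : CInfSpace.{u}) : ExtSpace.{u} := induced X univ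

/-- The restriction of `•f` to a subset of `•X` is an arrow of `•C^∞`. -/
def Hom.restrictExt {X : CInfSpace.{u}} {Y : CInfSpace.{v}} (f : CInfSpace.Hom X Y)
    {Z : Set (Ext X)} {W : Set (Ext Y)} (h : MapsTo (Ext.map f) Z W) :
    Hom (induced X Z) (induced Y W) where
  toFun := h.restrict _ _ _
  isHom {S d} hd := by
    intro s
    obtain ⟨V, hV, T, e, g, he, hg, hde⟩ := hd s
    refine ⟨V, hV, T, fun x => h.restrict _ _ _ (e x), g, ?_, hg,
      fun x => congrArg (h.restrict _ _ _) (hde x)⟩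
    rcases he with ⟨z, hz⟩ | ⟨V', k, hk, hek⟩
    · exact Or.inl ⟨h.restrict _ _ _ z, fun x => congrArg (h.restrict _ _ _) (hz x)⟩
    · refine Or.inr ⟨V', fun x => f (k x), f.isHom hk, fun x => ?_⟩
      obtain ⟨y, hy, hxy⟩ := hek x
      refine ⟨y, hy, ?_⟩
      change Ext.map f (e x).1 = _
      rw [hxy]
      exact (Ext.map_comp (X.homOfFig k hk) f y).symm

/-- The space `D` of first order infinitesimals as an extended space. -/
def D : ExtSpace.{0} := induced CInfSpace.real firstOrder

/-- The tangent bundle `TX = X^D` of an extended space. -/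
def tangent (X : ExtSpace.{u}) : ExtSpace.{u} := exp X D

end ExtSpace

/-! ## Standard tangent vectors -/

namespace CInfSpace

/-- The standard tangent vector `•f|_D` of an arrow `f : ℝ → X` of `C^∞`. -/
def extRestrictD {X : CInfSpace.{u}} (f : Hom real X) :
    (ExtSpace.ext X).tangent :=
  ExtSpace.Hom.restrictExt (Z := firstOrder) (W := univ) f (fun _ _ => mem_univ _)

/-- The `C^∞` space `T_st X` of standard tangent vectors: its support set is `{•f|_D | f : ℝ → X}`,
and a map `d` from an open set `U` of `ℝⁿ` is a figure iff, composed with the inclusion into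
`TX = (•X)^D`, it is a figure of the type of the standard points of `U`. -/
def standardTangent (X : CInfSpace.{u}) : CInfSpace.{u} where
  carrier := {t : (ExtSpace.ext X).tangent // ∃ f : Hom real X, t = extRestrictD f}
  IsFig U d := (ExtSpace.ext X).tangent.IsFig (ExtType.std U) (fun x => (d (ExtType.ofStd x)).1)
  fig_comp {_ _ U V d f} hd hf := (ExtSpace.ext X).tangent.fig_comp (S := ExtType.std U)
    (d := fun x => (d (ExtType.ofStd x)).1) hd (ExtType.isArrow_std hf)
  fig_const U t := (ExtSpace.ext X).tangent.fig_const _ t.1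
  fig_local {n U d} h := by
    refine (ExtSpace.ext X).tangent.fig_local (S := ExtType.std U)
      (d := fun x => (d (ExtType.ofStd x)).1) fun s => ?_
    obtain ⟨V, hV, hs, hd⟩ := h (ExtType.ofStd s)
    refine ⟨V, mem_extOpen_iff.2 hs, ?_⟩
    have hmem : ∀ x : (ExtType.std U).inter V, x.1 ∈ (ExtType.std V).carrier := by
      rintro ⟨_, ⟨u, hu, rfl⟩, hx⟩
      exact ⟨u, mem_extOpen_iff.1 hx, rfl⟩
    have harr : ExtType.IsArrow ((ExtType.std U).inter V) (ExtType.std V)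
        (fun x => ⟨x.1, hmem x⟩) := ExtType.isArrow_of_val (S := ExtType.std U) fun _ => rfl
    exact (ExtSpace.ext X).tangent.fig_comp (T := ExtType.std V)
      (d := fun x => ((d ∘ Opens.inclusion hV) (ExtType.ofStd x)).1) hd harr

/-- The standard tangent vector `•f|_D` as a point of `T_st X`. -/
def standardTangentMk {X : CInfSpace.{u}} (f : Hom real X) : X.standardTangent :=
  (⟨extRestrictD f, f, rfl⟩ :
    {t : (ExtSpace.ext X).tangent // ∃ f : Hom real X, t = extRestrictD f})

end CInfSpace
end InfDiffGeo

end

open InfDiffGeo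

/-! Why it is true. In a chart `e` around `f 0`, a smooth curve satisfies `e (f (h t)) = e (f 0) + h
t • (e ∘ f)' 0 + o(t)` whenever `h t = O(t)`. Charts are observables and observables are smooth, so
`•f|_D` records exactly the point `f 0` and the derivative there: two curves give the same standard
tangent vector iff their velocities agree (`extRestrictD_eq_iff`). Every tangent vector is the
velocity of a curve defined on all of `ℝ` (`exists_curve_velocity_eq`), so velocity is a bijection.
Everything takes place in a single chart, which is why no separation or countability of `M` enters.

It remains to match the figures.

Smooth families are figures (`isFig_of_contMDiff_velocity`). A smooth family of tangent vectors with
base points `x u` and fibre coordinates `b u` is locally the family of velocities of `F (u, y) = e⁻¹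
(e (x u) + y • b u)` (`exists_smooth_family`). On first order infinitesimals the given curves agree
with `F (u, ·)`, so the adjoint map `(u, h) ↦ d u h` is locally `•F` after a pairing of arrows.

Figures are smooth families (`contMDiff_velocity_of_isFig`). Testing a figure on the pairs `(u, a
t)` gives a figure of `•M`, which is locally constant or of the form `H (P t, u, a t)` with `H`
smooth (`exists_local_form`). The path `P` of the extended parameter may move much faster than `t`,
so it cannot simply be replaced by `P 0`. But `a = 0` gives `f u 0 ∼ H (P t, u, 0)` and `a = 1`
gives `f u t ∼ H (P t, u, t)`; on subtracting, the drift of `P` cancels, and strict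
differentiability at `(P 0, 0)` leaves the derivative in the last variable at `P 0`
(`velocity_eq_of_pathEq`). Hence the velocity of `f u` is that of `y ↦ H (P 0, u, y)`, which depends
smoothly on `u`. -/

noncomputable section

namespace InfDiffGeo

universe u v w

/-! ## Curves in manifolds and observables -/

section Manifold

variable {n : ℕ} {M : Type u} [TopologicalSpace M] [ChartedSpace (EuclideanSpace ℝ (Fin n)) M]

/-- A map on an open set is smooth iff it is smooth as a map on the ambient space. -/
theorem contMDiff_restrict_opens_iff {m : ℕ} {E' : Type*} [NormedAddCommGroup E']
    [NormedSpace ℝ E'] {H' : Type*} [TopologicalSpace H'] {J : ModelWithCorners ℝ E' H'}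
    {N : Type*} [TopologicalSpace N] [ChartedSpace H' N] {U : Opens (Euc m)} {F : Euc m → N} :
    ContMDiff 𝓘(ℝ, Euc m) J ∞ (fun x : U => F x) ↔ ContMDiffOn 𝓘(ℝ, Euc m) J ∞ F U := by
  constructor
  · intro h x hx
    exact (contMDiffAt_subtype_iff.1 (h ⟨x, hx⟩)).contMDiffWithinAt
  · intro h x
    exact contMDiffAt_subtype_iff.2 ((h x.1 x.2).contMDiffAt (U.isOpen.mem_nhds x.2))

/-- A map on an open set is the restriction of a map on the ambient space. -/
theorem exists_extension_opens {m : ℕ} {N : Type*} {U : Opens (Euc m)} (d : U → N) (x₀ : U) :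
    ∃ F : Euc m → N, ∀ x : U, F x = d x := by
  classical
  exact ⟨fun x => if hx : x ∈ U then d ⟨x, hx⟩ else d x₀, fun x => dif_pos x.2⟩

/-- The velocity at time `0` of a curve. -/
def velocity (f : ℝ → M) : TangentBundle (𝓡 n) M :=
  ⟨f 0, mfderiv 𝓘(ℝ, ℝ) (𝓡 n) f 0 (1 : ℝ)⟩

variable [IsManifold (𝓡 n) ∞ M]

theorem isFig_chart_symm (x : M) :
    (CInfSpace.ofManifold (𝓡 n) M).IsFig ⟨_, (chartAt (Euc n) x).open_target⟩
      (fun y => (chartAt (Euc n) x).symm y) :=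
  contMDiff_restrict_opens_iff.2 (contMDiffOn_chart_symm (I := 𝓡 n) (x := x))

/-- Inverse charts are figures, so a set open in the final topology has open preimage in every chart
target; transporting back by the chart gives a neighbourhood of each point. -/
theorem isOpen_of_isOpen_topology {A : Set M}
    (hA : IsOpen[(CInfSpace.ofManifold (𝓡 n) M).topology] A) : IsOpen A := by
  rw [isOpen_iff_mem_nhds]
  intro x hx
  set e := chartAt (Euc n) x
  have h1 := hA (isFig_chart_symm x)
  have h2 := e.open_target.isOpenMap_subtype_val _ h1
  refine mem_of_superset ((e.isOpen_inter_preimage h2).mem_nhds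
    ⟨mem_chart_source _ x, ⟨e x, mem_chart_target _ x⟩, ?_, rfl⟩) ?_
  · change e.symm (e x) ∈ A
    rwa [e.left_inv (mem_chart_source _ x)]
  · rintro y ⟨hy, ⟨z, hz⟩, hzA, hzy⟩
    change z = e y at hzy
    subst hzy
    change e.symm (e y) ∈ A at hzA
    rwa [e.left_inv hy] at hzA

end Manifold

/-! ### Velocities in charts and infinitesimal agreement of curves -/

section Velocity

variable {n : ℕ} {M : Type u} [TopologicalSpace M] [ChartedSpace (EuclideanSpace ℝ (Fin n)) M]

/-- The derivative of a curve composed with a map only depends on the velocity of the curve. -/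
theorem hasDerivAt_comp_velocity {k : ℕ} {φ : M → Euc k} {f : ℝ → M}
    (hφ : MDifferentiableAt (𝓡 n) 𝓘(ℝ, Euc k) φ (f 0))
    (hf : MDifferentiableAt 𝓘(ℝ, ℝ) (𝓡 n) f 0) :
    HasDerivAt (φ ∘ f)
      (mfderiv (𝓡 n) 𝓘(ℝ, Euc k) φ (velocity f : TangentBundle (𝓡 n) M).1
        (velocity f : TangentBundle (𝓡 n) M).2 : Euc k) 0 := by
  have h1 := HasMFDerivAt.comp 0 hφ.hasMFDerivAt hf.hasMFDerivAt
  have h2 : HasFDerivAt (φ ∘ f) ((mfderiv (𝓡 n) 𝓘(ℝ, Euc k) φ (f 0)).comp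
    (mfderiv 𝓘(ℝ, ℝ) (𝓡 n) f 0) : ℝ →L[ℝ] Euc k) 0 := hasMFDerivAt_iff_hasFDerivAt.1 h1
  have h3 : ∀ L : ℝ →L[ℝ] Euc k, HasFDerivAt (φ ∘ f) L 0 → HasDerivAt (φ ∘ f) (L 1) 0 :=
    fun L hL => hL.hasDerivAt
  exact h3 _ h2

variable [IsManifold (𝓡 n) ∞ M]

theorem mdifferentiableAt_chart {m x : M} (hx : x ∈ (chartAt (Euc n) m).source) :
    MDifferentiableAt (𝓡 n) 𝓘(ℝ, Euc n) (chartAt (Euc n) m) x :=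
  ((contMDiffOn_chart (I := 𝓡 n) (n := ∞) (x := m)).contMDiffAt
    ((chartAt (Euc n) m).open_source.mem_nhds hx)).mdifferentiableAt (by simp)

/-- The fibre coordinate of the trivialization at `m` is the derivative of the chart at `m`, so this
is the chain rule. -/
theorem trivializationAt_velocity {f : ℝ → M} (hf : MDifferentiableAt 𝓘(ℝ, ℝ) (𝓡 n) f 0) {m : M}
    (hm : f 0 ∈ (chartAt (Euc n) m).source) {v : Euc n}
    (hv : HasDerivAt (chartAt (Euc n) m ∘ f) v 0) :
    trivializationAt (Euc n) (TangentSpace (𝓡 n)) m (velocity f) = (f 0, v) := by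
  have hb : f 0 ∈ (trivializationAt (Euc n) (TangentSpace (𝓡 n)) m).baseSet := by
    rwa [TangentBundle.trivializationAt_baseSet]
  have h2 := (hasDerivAt_comp_velocity (mdifferentiableAt_chart hm) hf).unique hv
  refine Prod.ext (Bundle.Trivialization.coe_fst' _ hb) ?_
  have h1 := Bundle.Trivialization.continuousLinearMapAt_apply_of_mem ℝ
    (trivializationAt (Euc n) (TangentSpace (𝓡 n)) m) hb
    (mfderiv 𝓘(ℝ, ℝ) (𝓡 n) f 0 (1 : ℝ))
  rw [TangentBundle.continuousLinearMapAt_trivializationAt hm] at h1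
  refine h1.symm.trans (Eq.trans ?_ h2)
  have : (extChartAt (𝓡 n) m : M → Euc n) = chartAt (Euc n) m := by simp [mfld_simps]
  rw [this]
  rfl

/-- Injectivity of the trivialization on its source. It allows tangent vectors to be compared in one
vector space, without first identifying their fibres. -/
theorem eq_of_trivializationAt_eq {m : M} {a b : TangentBundle (𝓡 n) M}
    (ha : a.1 ∈ (chartAt (Euc n) m).source) (hb : b.1 ∈ (chartAt (Euc n) m).source)
    (h : trivializationAt (Euc n) (TangentSpace (𝓡 n)) m a =
      trivializationAt (Euc n) (TangentSpace (𝓡 n)) m b) : a = b := by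
  refine (trivializationAt (Euc n) (TangentSpace (𝓡 n)) m).toOpenPartialHomeomorph.injOn ?_ ?_ h
  · change a ∈ (trivializationAt (Euc n) (TangentSpace (𝓡 n)) m).source
    rw [TangentBundle.trivializationAt_source]
    exact ha
  · change b ∈ (trivializationAt (Euc n) (TangentSpace (𝓡 n)) m).source
    rw [TangentBundle.trivializationAt_source]
    exact hb

theorem velocity_eq_of_hasDerivAt {f g : ℝ → M} (hf : MDifferentiableAt 𝓘(ℝ, ℝ) (𝓡 n) f 0)
    (hg : MDifferentiableAt 𝓘(ℝ, ℝ) (𝓡 n) g 0) (h0 : f 0 = g 0) {m : M}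
    (hm : f 0 ∈ (chartAt (Euc n) m).source) {v : Euc n}
    (hfv : HasDerivAt (chartAt (Euc n) m ∘ f) v 0) (hgv : HasDerivAt (chartAt (Euc n) m ∘ g) v 0) :
    (velocity f : TangentBundle (𝓡 n) M) = velocity g := by
  refine eq_of_trivializationAt_eq (m := m) hm
    (show g 0 ∈ (chartAt (Euc n) m).source from h0 ▸ hm) ?_
  rw [trivializationAt_velocity hf hm hfv, trivializationAt_velocity hg (h0 ▸ hm) hgv, h0]

/-- Every tangent vector is the velocity of a globally defined smooth curve. -/
theorem exists_curve_velocity_eq (a : TangentBundle (𝓡 n) M) :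
    ∃ f : ℝ → M, ContMDiff 𝓘(ℝ, ℝ) (𝓡 n) ∞ f ∧ velocity f = a := by
  set e := chartAt (Euc n) a.1
  set v : Euc n := (trivializationAt (Euc n) (TangentSpace (𝓡 n)) a.1 a).2
  have hx : a.1 ∈ e.source := mem_chart_source _ _
  obtain ⟨r, hr, hball⟩ := Metric.isOpen_iff.1 e.open_target _ (e.map_source hx)
  -- The straight line with direction `v` may leave the chart. Replacing `t` by `sin (K t) / K`
  -- keeps derivative `1` at `0` and bounds the displacement by `‖v‖ / K < r`, so the curve stays in
  -- the ball for all times.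
  obtain ⟨K, hK⟩ := exists_nat_gt (‖v‖ / r)
  have hK0 : (0 : ℝ) < K := (div_nonneg (norm_nonneg _) hr.le).trans_lt hK
  let c : ℝ → Euc n := fun t => e a.1 + (Real.sin (K * t) / K) • v
  have hc : ContDiff ℝ ∞ c := by
    refine contDiff_const.add
      (ContDiff.smul (f := fun t : ℝ => Real.sin (K * t) / K) (ContDiff.div_const ?_ _)
        contDiff_const)
    exact Real.contDiff_sin.comp (contDiff_const.mul contDiff_id)
  have hct : ∀ t, c t ∈ e.target := by
    intro t
    refine hball ?_
    rw [Metric.mem_ball, dist_eq_norm, add_sub_cancel_left, norm_smul, norm_div,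
      Real.norm_of_nonneg hK0.le, div_mul_eq_mul_div, div_lt_iff₀ hK0]
    calc ‖Real.sin (K * t)‖ * ‖v‖ ≤ 1 * ‖v‖ :=
          mul_le_mul_of_nonneg_right (Real.abs_sin_le_one _) (norm_nonneg _)
      _ < r * K := by
          rw [one_mul, mul_comm]
          exact (div_lt_iff₀ hr).1 hK
  have hc0 : c 0 = e a.1 := by simp [c]
  have hcd : HasDerivAt c v 0 := by
    have h1 : HasDerivAt (fun t : ℝ => Real.sin (K * t)) (Real.cos (K * 0) * (K * 1)) 0 :=
      ((hasDerivAt_id (0 : ℝ)).const_mul (K : ℝ)).sin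
    have h2 := ((h1.div_const (K : ℝ)).smul_const v).const_add (e a.1)
    have h3 : Real.cos (K * 0) * (K * 1) / (K : ℝ) = 1 := by
      simp [hK0.ne']
    rwa [h3, one_smul] at h2
  have hf : ContMDiff 𝓘(ℝ, ℝ) (𝓡 n) ∞ (fun t => e.symm (c t)) :=
    ContMDiffOn.comp_contMDiff (contMDiffOn_chart_symm (I := 𝓡 n) (x := a.1)) hc.contMDiff hct
  have hf0 : e.symm (c 0) = a.1 := by rw [hc0, e.left_inv hx]
  refine ⟨_, hf, ?_⟩
  have hec : e ∘ (fun t => e.symm (c t)) = c := funext fun t => e.right_inv (hct t)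
  refine eq_of_trivializationAt_eq (m := a.1) (by change e.symm (c 0) ∈ _; rwa [hf0]) hx ?_
  rw [trivializationAt_velocity (v := v) (hf.mdifferentiableAt (by simp))
    (by rwa [hf0]) (by rwa [← hec] at hcd)]
  refine Prod.ext ?_ rfl
  change e.symm (c 0) = _
  rw [hf0]
  refine (Bundle.Trivialization.coe_fst' _ ?_).symm
  rw [TangentBundle.trivializationAt_baseSet]
  exact hx

/-- This is how information is extracted from infinitesimal equality of paths in `M`: it may be read
off in any chart. -/
theorem isObservable_chart (m : M) :
    (CInfSpace.ofManifold (𝓡 n) M).IsObservable (chartAt (Euc n) m).source ⊤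
      (chartAt (Euc n) m) := by
  refine ⟨fun hd => (chartAt (Euc n) m).open_source.preimage (ContMDiff.continuous hd),
    fun _ _ => trivial, ?_⟩
  intro k U d hd
  refine CInfSpace.isFig_ofOpen_iff.2 ?_
  exact ContMDiffOn.comp_contMDiff (f := fun x => (d x).1)
    (contMDiffOn_chart (I := 𝓡 n) (x := m)) hd fun x => (d x).2

/-- The inverse chart, restricted to the open part of its domain that lands in `A`, is a figure of
`A`. So `φ` read in the chart is smooth, and composing with the chart gives `φ` back near `x`. -/
theorem contMDiffAt_of_isObservable {A : Set M} {k : ℕ} {K : Opens (Euc k)} {φ : M → Euc k}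
    (h : (CInfSpace.ofManifold (𝓡 n) M).IsObservable A K φ) {x : M} (hx : x ∈ A) :
    ContMDiffAt (𝓡 n) 𝓘(ℝ, Euc k) ∞ φ x := by
  obtain ⟨hA, hm, hh⟩ := h
  have hAo := isOpen_of_isOpen_topology hA
  set e := chartAt (Euc n) x
  have hxe : x ∈ e.source := mem_chart_source _ x
  let B : Opens (Euc n) := ⟨_, e.isOpen_inter_preimage_symm hAo⟩
  have hfig : ContMDiff 𝓘(ℝ, Euc n) (𝓡 n) ∞ (fun y : B => e.symm y) :=
    contMDiff_restrict_opens_iff.2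
      ((contMDiffOn_chart_symm (I := 𝓡 n) (x := x)).mono inter_subset_left)
  have h1 := hh (U := B) (d := fun y => (⟨e.symm y, y.2.2⟩ : A)) hfig
  have h2 : ContMDiffOn 𝓘(ℝ, Euc n) 𝓘(ℝ, Euc k) ∞ (fun y => φ (e.symm y)) B :=
    contMDiff_restrict_opens_iff.1 (CInfSpace.isFig_ofOpen_iff.1 h1)
  have hxB : e x ∈ B := ⟨e.map_source hxe, by rwa [mem_preimage, e.left_inv hxe]⟩
  have h3 : ContMDiffAt (𝓡 n) 𝓘(ℝ, Euc k) ∞ ((fun y => φ (e.symm y)) ∘ e) x :=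
    ContMDiffAt.comp x ((h2 _ hxB).contMDiffAt (B.isOpen.mem_nhds hxB))
      ((contMDiffOn_chart (I := 𝓡 n) (x := x)).contMDiffAt (e.open_source.mem_nhds hxe))
  refine h3.congr_of_eventuallyEq ?_
  filter_upwards [e.open_source.mem_nhds hxe] with y hy
  change φ y = φ (e.symm (e y))
  rw [e.left_inv hy]

/-- Curves with the same velocity agree on first order infinitesimals. -/
theorem pathEq_comp_of_velocity_eq {f g : ℝ → M} (hf : MDifferentiableAt 𝓘(ℝ, ℝ) (𝓡 n) f 0)
    (hg : MDifferentiableAt 𝓘(ℝ, ℝ) (𝓡 n) g 0)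
    (h : (velocity f : TangentBundle (𝓡 n) M) = velocity g) {c : ℝ → ℝ}
    (hc : c =O[𝓝 0] (fun t : ℝ => t)) :
    (CInfSpace.ofManifold (𝓡 n) M).PathEq (fun t => f (c t)) (fun t => g (c t)) := by
  have h0 : f 0 = g 0 := congrArg Bundle.TotalSpace.proj h
  have hc0 : c 0 = 0 := by
    obtain ⟨C, hC⟩ := hc.bound
    simpa using hC.self_of_nhds
  have hct : Tendsto c (𝓝 0) (𝓝 0) := hc.trans_tendsto tendsto_id
  intro A k K φ hφ
  -- Since `c 0 = 0` and `f 0 = g 0`, both paths start at the same point, so only the `o(t)` clause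
  -- remains.
  simp only [hc0, h0, true_and]
  intro hA
  have hφd := (contMDiffAt_of_isObservable hφ hA).mdifferentiableAt (by simp)
  obtain ⟨v, h1, h2⟩ : ∃ v : Euc k, HasDerivAt (φ ∘ f) v 0 ∧ HasDerivAt (φ ∘ g) v 0 := by
    refine ⟨_, ?_, hasDerivAt_comp_velocity hφd hg⟩
    rw [← h]
    exact hasDerivAt_comp_velocity (h0 ▸ hφd) hf
  -- `φ ∘ f - φ ∘ g` vanishes at `0` together with its derivative, hence is `o(y)`; substituting `y
  -- = c t = O(t)` gives `o(t)`.
  have h3 := (h1.sub h2).isLittleO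
  have h4 : (fun y : ℝ => φ (f y) - φ (g y)) =o[𝓝 0] (fun y : ℝ => y) := by
    simpa [h0] using h3
  exact (h4.comp_tendsto hct).trans_isBigO hc

/-- The domain of the chart at `f 0` contains `g 0` by the membership clause of the relation, and an
`o(t)` bound evaluated at `t = 0` forces equal coordinates. No Hausdorff property is needed. -/
theorem eq_zero_of_pathEq {f g : ℝ → M}
    (h : (CInfSpace.ofManifold (𝓡 n) M).PathEq f g) : f 0 = g 0 := by
  have hm := mem_chart_source (Euc n) (f 0)
  obtain ⟨h1, h2⟩ := h _ ⊤ _ (isObservable_chart (n := n) (f 0))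
  exact (chartAt (Euc n) (f 0)).injOn hm (h1.1 hm)
    (sub_eq_zero.1 (CInfSpace.eq_zero_of_isLittleO (h2 hm)))

/-- If a smooth family of curves, with a parameter depending continuously on the scale, agrees
infinitesimally with a curve, then the velocities agree. -/
theorem velocity_eq_of_pathEq {E : Type*} [NormedAddCommGroup E] [NormedSpace ℝ E] {f : ℝ → M}
    (hf : MDifferentiableAt 𝓘(ℝ, ℝ) (𝓡 n) f 0) {H : E × ℝ → M} {P : ℝ → E}
    (hP : Tendsto P (𝓝 0) (𝓝 (P 0)))
    (hH : ContMDiffAt 𝓘(ℝ, E × ℝ) (𝓡 n) ∞ H (P 0, 0))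
    (h0 : (CInfSpace.ofManifold (𝓡 n) M).PathEq (fun _ => f 0) (fun t => H (P t, 0)))
    (h1 : (CInfSpace.ofManifold (𝓡 n) M).PathEq f (fun t => H (P t, t))) :
    (velocity f : TangentBundle (𝓡 n) M) = velocity (fun y => H (P 0, y)) := by
  have hb : f 0 = H (P 0, 0) := eq_zero_of_pathEq h0
  have hm : f 0 ∈ (chartAt (Euc n) (f 0)).source := mem_chart_source _ _
  set e := chartAt (Euc n) (f 0)
  have hmH : H (P 0, 0) ∈ e.source := hb ▸ hm
  have hι : ContMDiff 𝓘(ℝ, ℝ) 𝓘(ℝ, E × ℝ) ∞ (fun y : ℝ => (P 0, y)) :=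
    ContDiff.contMDiff (by fun_prop)
  have hg : ContMDiffAt 𝓘(ℝ, ℝ) (𝓡 n) ∞ (fun y => H (P 0, y)) 0 :=
    ContMDiffAt.comp (0 : ℝ) (f := fun y : ℝ => (P 0, y)) hH hι.contMDiffAt
  have hG : ContDiffAt ℝ ∞ (fun z => e (H z)) (P 0, 0) := by
    refine ContMDiffAt.contDiffAt (ContMDiffAt.comp (P 0, (0 : ℝ)) (g := e) ?_ hH)
    exact (contMDiffOn_chart (I := 𝓡 n)).contMDiffAt (e.open_source.mem_nhds hmH)
  -- Strict differentiability is essential: below, both points `(P t, t)` and `(P t, 0)` move with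
  -- `t`, and `P t - P 0` need not be `O(t)`.
  have hG' := hG.hasStrictFDerivAt (by simp)
  set L := fderiv ℝ (fun z => e (H z)) (P 0, 0)
  have hgd : HasDerivAt (fun y : ℝ => e (H (P 0, y))) (L (0, 1)) 0 := by
    have h2 : HasDerivAt (fun y : ℝ => (P 0, y)) ((0 : E), (1 : ℝ)) 0 :=
      (hasDerivAt_const _ _).prodMk (hasDerivAt_id _)
    exact hG'.hasFDerivAt.comp_hasDerivAt (0 : ℝ) h2
  have hfd : HasDerivAt (fun y => e (f y)) (L (0, 1)) 0 := by
    have o0 := (h0 _ _ _ (isObservable_chart (n := n) (f 0))).2 hm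
    have o1 := (h1 _ _ _ (isObservable_chart (n := n) (f 0))).2 hm
    have hlim : Tendsto (fun t : ℝ => (((P t, t) : E × ℝ), ((P t, 0) : E × ℝ))) (𝓝 0)
        (𝓝 ((P 0, 0), (P 0, 0))) :=
      (hP.prodMk_nhds tendsto_id).prodMk_nhds (hP.prodMk_nhds tendsto_const_nhds)
    have o2 := hG'.isLittleO.comp_tendsto hlim
    have o3 : (fun t : ℝ => e (H (P t, t)) - e (H (P t, 0)) - t • L (0, 1)) =o[𝓝 0]
        (fun t : ℝ => t) := by
      have o4 := o2.trans_isBigO (k := fun t : ℝ => t)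
        (IsBigO.of_bound 1 (Eventually.of_forall fun t => by simp))
      refine o4.congr_left fun t => ?_
      have : ((0 : E), t) = t • ((0 : E), (1 : ℝ)) := by simp
      simp only [Function.comp, Prod.mk_sub_mk, sub_self, sub_zero]
      rw [this, map_smul]
    rw [hasDerivAt_iff_isLittleO]
    -- Telescoping through `e (H (P t, t))` and `e (H (P t, 0))`: the drift of the parameter occurs
    -- in both and cancels.
    have o5 := (o1.sub o0).add o3
    have o6 : (fun t => e (f t) - e (f 0) - t • L (0, 1)) =o[𝓝 0] (fun t : ℝ => t) :=
      o5.congr_left fun t => by abel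
    simpa using o6
  exact velocity_eq_of_hasDerivAt hf (hg.mdifferentiableAt (by simp)) hb hm hfd hgd

end Velocity

/-! ## Extended points -/

namespace CInfSpace

/-- Nilpotency and the relation only involve the germ at `0`; the filter `𝓝 0` is not punctured, so
the values at `0` agree as well. -/
theorem Represents.congr_of_eventuallyEq {X : CInfSpace.{u}} {c c' : ℝ → X} {x : Ext X}
    (h : Represents c x) (he : ∀ᶠ t in 𝓝 0, c' t = c t) : Represents c' x := by
  have h0 : c' 0 = c 0 := he.self_of_nhds
  refine h.of_pathEq ⟨?_, ?_⟩ ?_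
  · have h1 : Tendsto c (𝓝 0) (@nhds _ X.topology (c 0)) := h.1.1
    change Tendsto c' (𝓝 0) (@nhds _ X.topology (c' 0))
    rw [h0]
    exact h1.congr' (he.mono fun t ht => ht.symm)
  · intro U k K φ hφ hU
    obtain ⟨j, hj⟩ := h.1.2 U K φ hφ (h0 ▸ hU)
    refine ⟨j, hj.congr' ?_ EventuallyEq.rfl⟩
    filter_upwards [he] with t ht
    rw [ht, h0]
  · intro U k K φ _
    refine ⟨by rw [h0], fun _ => ?_⟩
    refine (isLittleO_zero (fun t : ℝ => t) (𝓝 0)).congr' ?_ EventuallyEq.rfl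
    filter_upwards [he] with t ht
    rw [ht, sub_self]

/-- By `pathEq_ofOpen`, an `o(t)` difference in the ambient space already gives equality in `•V`;
observables of `V` detect nothing finer. -/
theorem extMap_incl_injective {n : ℕ} (V : Opens (Euc n)) :
    Function.Injective (Ext.map (incl V)) := by
  intro y z h
  obtain ⟨c, hc⟩ := exists_represents y
  obtain ⟨d, hd⟩ := exists_represents z
  have h1 := hc.map (incl V)
  have h2 := hd.map (incl V)
  rw [← h] at h2
  obtain ⟨k, hk⟩ := h1.1.exists_pow
  exact hc.eq hd (pathEq_ofOpen (tendsto_of_pow hk) (h1.pathEq h2).sub_isLittleO)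

/-- The extension of a figure is computed on representatives, for any extension of the figure
off its domain. -/
theorem represents_map_homOfFig {X : CInfSpace.{u}} {n : ℕ} {V : Opens (Euc n)} {h : V → X}
    (hh : X.IsFig V h) {F : Euc n → X} (hF : ∀ x : V, F x = h x) {y : Ext (ofOpen V)}
    {ξ : ℝ → Euc n} (hξ : Represents (X := euc n) ξ (Ext.map (incl V) y)) :
    Represents (fun t => F (ξ t)) (Ext.map (X.homOfFig h hh) y) := by
  obtain ⟨c, z, hc, hz, hev⟩ := exists_lift (mem_extOpen_iff.1 ⟨y, rfl⟩) hξ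
  obtain rfl := extMap_incl_injective V hz
  refine (hc.map (X.homOfFig h hh)).congr_of_eventuallyEq ?_
  filter_upwards [hev] with t ht
  rw [← ht]
  exact hF (c t)

/-- The isomorphism `ℝᵐ⁺ⁿ ≅ ℝᵐ × ℝⁿ`. -/
abbrev eucProd (m n : ℕ) : Euc (m + n) ≃L[ℝ] Euc m × Euc n :=
  EuclideanSpace.finAddEquivProd (𝕜 := ℝ) (n := m) (m := n)

/-- The first projection of `ℝᵐ⁺ⁿ`. -/
def eucFst (m n : ℕ) : Hom (euc (m + n)) (euc m) :=
  Hom.ofContMDiff (fun z : Euc (m + n) => (eucProd m n z).1) (ContDiff.contMDiff (by fun_prop))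

/-- The second projection of `ℝᵐ⁺ⁿ`. -/
def eucSnd (m n : ℕ) : Hom (euc (m + n)) (euc n) :=
  Hom.ofContMDiff (fun z : Euc (m + n) => (eucProd m n z).2) (ContDiff.contMDiff (by fun_prop))

/-- The pair of two extended points. -/
def Ext.pair {m n : ℕ} (x : Ext (euc m)) (y : Ext (euc n)) : Ext (euc (m + n)) :=
  Quotient.mk (euc (m + n)).pathSetoid
    ⟨fun t => (eucProd m n).symm ((exists_represents x).choose t, (exists_represents y).choose t),
      ExtType.pair_nilpotent (exists_represents x).choose_spec.1
        (exists_represents y).choose_spec.1⟩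

theorem Represents.pair {m n : ℕ} {x : Ext (euc m)} {y : Ext (euc n)} {c : ℝ → Euc m}
    {d : ℝ → Euc n} (hc : Represents (X := euc m) c x) (hd : Represents (X := euc n) d y) :
    Represents (X := euc (m + n)) (fun t => (eucProd m n).symm (c t, d t)) (Ext.pair x y) := by
  have hx := (exists_represents x).choose_spec
  have hy := (exists_represents y).choose_spec
  have hnil := ExtType.pair_nilpotent hx.1 hy.1
  refine Represents.of_pathEq ⟨hnil, rfl⟩ (ExtType.pair_nilpotent hc.1 hd.1) ?_
  obtain ⟨k, hk⟩ := IsNilpotentPath.exists_pow hnil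
  refine pathEq_euc (tendsto_of_pow hk) ?_
  have h1 := (hx.pathEq hc).sub_isLittleO.prod_left (hy.pathEq hd).sub_isLittleO
  have h2 := (((eucProd m n).symm : Euc m × Euc n →L[ℝ] Euc (m + n)).isBigO_comp _
    (𝓝 0)).trans_isLittleO h1
  refine h2.congr_left fun t => ?_
  rw [← map_sub]
  rfl

theorem Ext.map_fst_pair {m n : ℕ} (x : Ext (euc m)) (y : Ext (euc n)) :
    Ext.map (eucFst m n) (Ext.pair x y) = x := by
  obtain ⟨c, hc⟩ := exists_represents x
  obtain ⟨d, hd⟩ := exists_represents y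
  refine ((hc.pair hd).map (eucFst m n)).eq hc ?_
  have : (fun t => eucFst m n ((eucProd m n).symm (c t, d t))) = c := by
    funext t
    exact congrArg Prod.fst ((eucProd m n).apply_symm_apply _)
  rw [this]
  exact PathEq.refl _ _

theorem Ext.map_snd_pair {m n : ℕ} (x : Ext (euc m)) (y : Ext (euc n)) :
    Ext.map (eucSnd m n) (Ext.pair x y) = y := by
  obtain ⟨c, hc⟩ := exists_represents x
  obtain ⟨d, hd⟩ := exists_represents y
  refine ((hc.pair hd).map (eucSnd m n)).eq hd ?_
  have : (fun t => eucSnd m n ((eucProd m n).symm (c t, d t))) = d := by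
    funext t
    exact congrArg Prod.snd ((eucProd m n).apply_symm_apply _)
  rw [this]
  exact PathEq.refl _ _

/-- The isomorphism `ℝ → ℝ¹`. -/
def realToEuc : Hom real (euc 1) :=
  Hom.ofContMDiff (fun t : ℝ => t • EuclideanSpace.single (0 : Fin 1) (1 : ℝ))
    (ContDiff.contMDiff (by fun_prop))

/-- The isomorphism `ℝ¹ → ℝ`. -/
def eucToReal : Hom (euc 1) real :=
  Hom.ofContMDiff (fun z : Euc 1 => z 0) (ContDiff.contMDiff (by fun_prop))

theorem eucToReal_realToEuc_apply (t : ℝ) : eucToReal (realToEuc t) = t := by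
  change (t • EuclideanSpace.single (0 : Fin 1) (1 : ℝ) : Euc 1) 0 = t
  simp

theorem eucToReal_realToEuc (x : Ext real) : Ext.map eucToReal (Ext.map realToEuc x) = x := by
  rw [← Ext.map_comp]
  obtain ⟨c, hc⟩ := exists_represents x
  refine (hc.map (realToEuc.comp eucToReal)).eq hc ?_
  have : (fun t => (realToEuc.comp eucToReal) (c t)) = c := by
    funext t
    exact eucToReal_realToEuc_apply (c t)
  rw [this]
  exact PathEq.refl _ _

theorem isNilpotentPath_mul (a : ℝ) : real.IsNilpotentPath (fun t : ℝ => a * t) := by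
  have h : (euc 1).IsNilpotentPath
      (fun t => (a * t) • EuclideanSpace.single (0 : Fin 1) (1 : ℝ)) := by
    -- The exponent `2` suffices because `(a t)² = o(t)`.
    refine isNilpotentPath_euc (k := 2) ?_
    have h1 : (fun t : ℝ => a ^ 2 * t ^ 2) =o[𝓝 0] (fun t : ℝ => t) :=
      (isLittleO_pow_id one_lt_two).const_mul_left _
    refine h1.congr_left fun t => ?_
    simp [norm_smul, mul_pow]
  have h2 := h.map eucToReal
  have : (fun t : ℝ => a * t) = fun t => eucToReal (realToEuc (a * t)) :=
    funext fun t => (eucToReal_realToEuc_apply _).symm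
  rw [this]
  exact h2

/-- The first order infinitesimal represented by `t ↦ a t`. -/
def infinitesimal (a : ℝ) : firstOrder :=
  ⟨Quotient.mk real.pathSetoid ⟨fun t => a * t, isNilpotentPath_mul a⟩,
    fun t => a * t, ⟨isNilpotentPath_mul a, rfl⟩, isBigO_const_mul_self _ _ _⟩

theorem represents_infinitesimal (a : ℝ) :
    Represents (X := real) (fun t => a * t) (infinitesimal a).1 :=
  ⟨isNilpotentPath_mul a, rfl⟩

end CInfSpace

/-! ## Arrows of types and figures of extended spaces -/

namespace ExtType

open CInfSpace

/-- The case without a parameter: `p` is taken in the zero-dimensional space. -/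
theorem isArrow_of_contDiffOn {S T : ExtType} {f : S → T} {V : Opens (Euc S.dim)}
    {h : Euc S.dim → Euc T.dim} (hh : ContDiffOn ℝ ∞ h V) (hV : ∀ x : S, x.1 ∈ extOpen V)
    (hf : ∀ (x : S) (ξ : ℝ → Euc S.dim), Represents (X := euc S.dim) ξ x.1 →
      Represents (X := euc T.dim) (fun t => h (ξ t)) (f x).1) : IsArrow S T f := by
  intro s
  refine ⟨0, hat (X := euc 0) 0, ⊤, V, fun z => h z.2, mem_extOpen_iff.2 trivial, hV s,
    hh.comp contDiff_snd.contDiffOn fun y hy => hy.2, ?_⟩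
  intro x _ P ξ _ hξ
  exact hf x ξ hξ

/-- The two extended parameters are merged into the single parameter `Ext.pair p₁ p₂`, and the two
local expressions are used side by side on the intersection of their domains. -/
theorem isArrow_pair {S T₁ T₂ : ExtType} {f₁ : S → T₁} {f₂ : S → T₂} (h₁ : IsArrow S T₁ f₁)
    (h₂ : IsArrow S T₂ f₂) :
    IsArrow S ⟨T₁.dim + T₂.dim, univ⟩ (fun x => ⟨Ext.pair (f₁ x).1 (f₂ x).1, trivial⟩) := by
  intro s
  obtain ⟨q₁, p₁, U₁, V₁, g₁, hp₁, hs₁, hg₁, hf₁⟩ := h₁ s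
  obtain ⟨q₂, p₂, U₂, V₂, g₂, hp₂, hs₂, hg₂, hf₂⟩ := h₂ s
  let L : Euc (q₁ + q₂) ≃L[ℝ] Euc q₁ × Euc q₂ := eucProd q₁ q₂
  let U : Opens (Euc (q₁ + q₂)) :=
    ⟨{z | (L z).1 ∈ U₁ ∧ (L z).2 ∈ U₂}, (U₁.isOpen.preimage (by fun_prop)).inter
      (U₂.isOpen.preimage (by fun_prop))⟩
  obtain ⟨P₁, hP₁⟩ := exists_represents p₁
  obtain ⟨P₂, hP₂⟩ := exists_represents p₂
  refine ⟨q₁ + q₂, Ext.pair p₁ p₂, U, V₁ ⊓ V₂,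
    fun z => (eucProd T₁.dim T₂.dim).symm (g₁ ((L z.1).1, z.2), g₂ ((L z.1).2, z.2)),
    ?_, ?_, ?_, ?_⟩
  · rw [mem_extOpen_iff, (hP₁.pair hP₂).st_eq]
    have : L ((eucProd q₁ q₂).symm (P₁ 0, P₂ 0)) = (P₁ 0, P₂ 0) :=
      (eucProd q₁ q₂).apply_symm_apply _
    change (L ((eucProd q₁ q₂).symm (P₁ 0, P₂ 0))).1 ∈ U₁ ∧
      (L ((eucProd q₁ q₂).symm (P₁ 0, P₂ 0))).2 ∈ U₂
    rw [this, ← hP₁.st_eq, ← hP₂.st_eq]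
    exact ⟨mem_extOpen_iff.1 hp₁, mem_extOpen_iff.1 hp₂⟩
  · exact mem_extOpen_iff.2 ⟨mem_extOpen_iff.1 hs₁, mem_extOpen_iff.1 hs₂⟩
  · refine (eucProd T₁.dim T₂.dim).symm.contDiff.comp_contDiffOn (ContDiffOn.prodMk ?_ ?_)
    · exact hg₁.comp (f := fun z : Euc (q₁ + q₂) × Euc S.dim => ((L z.1).1, z.2))
        (ContDiff.contDiffOn (by fun_prop)) fun z hz => ⟨hz.1.1, hz.2.1⟩
    · exact hg₂.comp (f := fun z : Euc (q₁ + q₂) × Euc S.dim => ((L z.1).2, z.2))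
        (ContDiff.contDiffOn (by fun_prop)) fun z hz => ⟨hz.1.2, hz.2.2⟩
  · intro x hx Q ξ hQ hξ
    have hx' := mem_extOpen_iff.1 hx
    have hQ₁ := hQ.map (eucFst q₁ q₂)
    have hQ₂ := hQ.map (eucSnd q₁ q₂)
    rw [Ext.map_fst_pair] at hQ₁
    rw [Ext.map_snd_pair] at hQ₂
    exact (hf₁ x (mem_extOpen_iff.2 hx'.1) _ ξ hQ₁ hξ).pair
      (hf₂ x (mem_extOpen_iff.2 hx'.2) _ ξ hQ₂ hξ)

end ExtType

/-! ### Figures of subsets of extensions -/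

namespace ExtSpace

open CInfSpace ExtType

theorem isFig_induced_of_isGenFig {X : CInfSpace.{u}} {Z : Set (Ext X)} {S : ExtType} {d : S → Z}
    (hd : IsGenFig X Z S d) : (induced X Z).IsFig S d :=
  fun _ => ⟨⊤, mem_extOpen_iff.2 trivial, S, d, S.interIncl ⊤, hd, isArrow_interIncl S ⊤,
    fun _ => rfl⟩

/-- Restrictions of extensions of arrows are figures. -/
theorem isFig_induced_of_map {X : CInfSpace.{u}} {Z : Set (Ext X)} {S : ExtType} {d : S → Z}
    (F : CInfSpace.Hom (euc S.dim) X) (hd : ∀ x, (d x).1 = Ext.map F x.1) :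
    (induced X Z).IsFig S d := by
  have hF : X.IsFig ⊤ (fun z : (⊤ : Opens (Euc S.dim)) => F z.1) :=
    F.isHom (d := fun z : (⊤ : Opens (Euc S.dim)) => z.1) contMDiff_subtype_val
  refine isFig_induced_of_isGenFig (Or.inr ⟨⊤, fun z => F z.1, hF, fun x => ?_⟩)
  obtain ⟨y, hy⟩ : x.1 ∈ extOpen (⊤ : Opens (Euc S.dim)) := mem_extOpen_iff.2 trivial
  refine ⟨y, hy, ?_⟩
  rw [hd, ← hy, ← Ext.map_comp]
  rfl

/-- An arrow to `ℝᵏ` takes figures of subsets of `•X` to arrows of types. -/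
theorem isArrow_map_of_isFig {X : CInfSpace.{u}} {Z : Set (Ext X)} {S : ExtType} {d : S → Z}
    (hd : (induced X Z).IsFig S d) {k : ℕ} (F : CInfSpace.Hom X (euc k)) :
    IsArrow S ⟨k, univ⟩ (fun x => ⟨Ext.map F (d x).1, trivial⟩) := by
  refine (ofType ⟨k, univ⟩).fig_local fun s => ?_
  obtain ⟨V, hs, T, e, g, he, hg, hde⟩ := hd s
  refine ⟨V, hs, ?_⟩
  have key : IsArrow T ⟨k, univ⟩ (fun x => ⟨Ext.map F (e x).1, trivial⟩) := by
    rcases he with ⟨z, hz⟩ | ⟨W, h, hh, hW⟩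
    · simp only [hz]
      exact isArrow_const T ⟨k, univ⟩ ⟨Ext.map F z.1, trivial⟩
    -- Extending `F ∘ h` off `W` needs a default value. If `W` is empty then so is `T`, as each of
    -- its points comes from a path in `W`.
    · by_cases hne : Nonempty W
      · obtain ⟨w⟩ := hne
        obtain ⟨G, hG⟩ := exists_extension_opens (fun x => F (h x)) w
        refine isArrow_of_contDiffOn (V := W) (h := G) ?_
          (fun x => (hW x).imp fun y hy => hy.1) ?_
        · rw [← contMDiffOn_iff_contDiffOn, ← contMDiff_restrict_opens_iff]
          simp only [hG]
          exact F.isHom hh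
        · intro x ξ hξ
          obtain ⟨y, hy, hxy⟩ := hW x
          rw [← hy] at hξ
          have h1 := represents_map_homOfFig (X := euc k) (F.isHom hh) hG hξ
          change Represents _ (Ext.map F (e x).1)
          rw [hxy, ← Ext.map_comp]
          exact h1
      · intro x
        obtain ⟨y, -⟩ := hW x
        obtain ⟨c, -⟩ := exists_represents y
        exact (hne ⟨c 0⟩).elim
  have h2 := hg.comp key
  simp only [← hde] at h2
  exact h2

end ExtSpace

open CInfSpace ExtType ExtSpace

/-! ### Local form of figures of `•M`, and standard tangent vectors as velocities -/

section Figures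

variable {n : ℕ} {M : Type u} [TopologicalSpace M] [ChartedSpace (EuclideanSpace ℝ (Fin n)) M]

/-- Arrows `ℝ → M` are smooth. -/
theorem contMDiff_of_hom (f : CInfSpace.Hom real (ofManifold (𝓡 n) M)) :
    ContMDiff 𝓘(ℝ, ℝ) (𝓡 n) ∞ f.toFun := by
  -- Figures are indexed by open subsets of `Euc n`, so the identity of `ℝ` is tested through `ℝ¹ ≅
  -- ℝ` and transported back afterwards.
  have h1 := f.isHom (U := (⊤ : Opens (Euc 1))) (d := fun z => eucToReal z.1)
    (contMDiff_restrict_opens_iff.2 (ContDiff.contMDiff (by fun_prop :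
      ContDiff ℝ ∞ (fun z : Euc 1 => z 0))).contMDiffOn)
  have h2 : ContMDiffOn 𝓘(ℝ, Euc 1) (𝓡 n) ∞ (fun z => f (eucToReal z)) univ :=
    (contMDiff_restrict_opens_iff (U := ⊤) (F := fun z => f (eucToReal z))).1 h1
  have h3 : ContMDiff 𝓘(ℝ, ℝ) 𝓘(ℝ, Euc 1) ∞ realToEuc.toFun :=
    ContDiff.contMDiff (by
      change ContDiff ℝ ∞ fun t : ℝ => t • EuclideanSpace.single (0 : Fin 1) (1 : ℝ)
      fun_prop)
  have h4 := (contMDiffOn_univ.1 h2).comp h3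
  have : f.toFun = (fun z => f (eucToReal z)) ∘ realToEuc.toFun :=
    funext fun t => congrArg f.toFun (eucToReal_realToEuc_apply t).symm
  rw [this]
  exact h4

theorem mdifferentiableAt_of_hom (f : CInfSpace.Hom real (ofManifold (𝓡 n) M)) :
    MDifferentiableAt 𝓘(ℝ, ℝ) (𝓡 n) f.toFun 0 :=
  (contMDiff_of_hom f).mdifferentiableAt (by simp)

/-- A figure of the extension of a manifold is locally constant, or locally the extension of a
smooth map with an extended parameter. -/
theorem exists_local_form {S : ExtType} {δ : S → ExtSpace.ext (ofManifold (𝓡 n) M)}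
    (hδ : (ExtSpace.ext (ofManifold (𝓡 n) M)).IsFig S δ) (s : S) :
    ∃ V : Opens (Euc S.dim), s.1 ∈ extOpen V ∧
      ((∀ x : S, x.1 ∈ extOpen V → δ x = δ s) ∨
        ∃ (q : ℕ) (P : ℝ → Euc q) (O : Set (Euc q × Euc S.dim)) (H : Euc q × Euc S.dim → M),
          Tendsto P (𝓝 0) (𝓝 (P 0)) ∧ IsOpen O ∧ (P 0, st (n := S.dim) s.1) ∈ O ∧
          ContMDiffOn 𝓘(ℝ, Euc q × Euc S.dim) (𝓡 n) ∞ H O ∧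
          ∀ x : S, x.1 ∈ extOpen V → ∀ ξ : ℝ → Euc S.dim, Represents (X := euc S.dim) ξ x.1 →
            Represents (X := ofManifold (𝓡 n) M) (fun t => H (P t, ξ t)) (δ x).1) := by
  obtain ⟨V, hs, T, d, k, hd, hk, hδk⟩ := hδ s
  rcases hd with ⟨z, hz⟩ | ⟨W, h, hh, hW⟩
  · refine ⟨V, hs, Or.inl fun x hx => ?_⟩
    have h1 := (hδk ⟨x.1, x.2, hx⟩).trans (hz _)
    have h2 := (hδk ⟨s.1, s.2, hs⟩).trans (hz _)
    exact h1.trans h2.symm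
  · obtain ⟨q, p, U, (V' : Opens (Euc S.dim)), (g : Euc q × Euc S.dim → Euc T.dim),
      hp, hs', hg, hgk⟩ := hk ⟨s.1, s.2, hs⟩
    obtain ⟨P, hP⟩ := exists_represents p
    obtain ⟨j, hj⟩ := hP.1.exists_pow
    -- The image of `s` lies in `•W`, so `W` is nonempty and `c₀ 0` can serve as the default value
    -- of `F` off `W`.
    obtain ⟨y₀, hy₀, -⟩ := hW (k ⟨s.1, s.2, hs⟩)
    obtain ⟨c₀, -⟩ := exists_represents y₀
    obtain ⟨F, hF⟩ := exists_extension_opens h (c₀ 0)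
    have hUV : IsOpen ((U : Set (Euc q)) ×ˢ (V' : Set (Euc S.dim))) := U.isOpen.prod V'.isOpen
    have hF' : ContMDiffOn 𝓘(ℝ, Euc T.dim) (𝓡 n) ∞ F W := by
      rw [← contMDiff_restrict_opens_iff]
      simp only [hF]
      exact hh
    refine ⟨V ⊓ V', mem_extOpen_iff.2 ⟨mem_extOpen_iff.1 hs, mem_extOpen_iff.1 hs'⟩,
      Or.inr ⟨q, P, _, fun z => F (g z), tendsto_of_pow hj,
        hg.continuousOn.isOpen_inter_preimage hUV W.isOpen, ⟨⟨?_, ?_⟩, ?_⟩, ?_, ?_⟩⟩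
    · change P 0 ∈ U
      rw [← hP.st_eq]
      exact mem_extOpen_iff.1 hp
    · exact mem_extOpen_iff.1 hs'
    · obtain ⟨ξ, hξ⟩ := exists_represents s.1
      have h1 := hgk ⟨s.1, s.2, hs⟩ hs' P ξ hP hξ
      change g (P 0, st (n := S.dim) s.1) ∈ W
      have h2 : g (P 0, ξ 0) ∈ W := h1.st_eq ▸ mem_extOpen_iff.1 ⟨y₀, hy₀⟩
      rwa [← hξ.st_eq] at h2
    · exact hF'.comp (hg.contMDiffOn.mono inter_subset_left) inter_subset_right
    · intro x hx ξ hξ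
      have hx' := mem_extOpen_iff.1 hx
      let x' : S.inter V := ⟨x.1, x.2, mem_extOpen_iff.2 hx'.1⟩
      have h1 := hgk x' (mem_extOpen_iff.2 hx'.2) P ξ hP hξ
      obtain ⟨y, hy, hdy⟩ := hW (k x')
      rw [← hy] at h1
      have h2 : (δ x).1 = Ext.map ((ofManifold (𝓡 n) M).homOfFig h hh) y :=
        (congrArg Subtype.val (hδk x')).trans hdy
      rw [h2]
      exact represents_map_homOfFig hh hF h1

variable [IsManifold (𝓡 n) ∞ M]

/-- The single infinitesimal `t ↦ t` detects the derivative. This is `velocity_eq_of_pathEq` with a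
constant parameter. -/
theorem velocity_eq_of_map_eq {f g : CInfSpace.Hom real (ofManifold (𝓡 n) M)}
    (h0 : f 0 = g 0)
    (h : Ext.map f (infinitesimal 1).1 = Ext.map g (infinitesimal 1).1) :
    (velocity f.toFun : TangentBundle (𝓡 n) M) = velocity g.toFun := by
  have h1 := (represents_infinitesimal 1).map f
  rw [h] at h1
  have h2 := h1.pathEq ((represents_infinitesimal 1).map g)
  simp only [one_mul] at h2
  refine velocity_eq_of_pathEq (E := ℝ) (P := fun _ => 0) (H := fun z => g z.2)
    (mdifferentiableAt_of_hom f) tendsto_const_nhds ?_ ?_ h2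
  · exact (contMDiff_of_hom g).contMDiffAt.comp _
      (contDiff_snd.contMDiff : ContMDiff 𝓘(ℝ, ℝ × ℝ) 𝓘(ℝ, ℝ) ∞ Prod.snd).contMDiffAt
  · change PathEq _ (fun _ => f 0) (fun _ => g 0)
    rw [h0]
    exact PathEq.refl _ _

/-- Standard tangent vectors are equal iff the velocities are. -/
theorem extRestrictD_eq_iff {f g : CInfSpace.Hom real (ofManifold (𝓡 n) M)} :
    extRestrictD f = extRestrictD g ↔
      (velocity f.toFun : TangentBundle (𝓡 n) M) = velocity g.toFun := by
  constructor
  · intro h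
    have h1 : Ext.map f (infinitesimal 1).1 = Ext.map g (infinitesimal 1).1 :=
      congrArg (fun t : (ExtSpace.ext (ofManifold (𝓡 n) M)).tangent =>
        (t.toFun (infinitesimal 1)).1) h
    have h2 := (represents_infinitesimal 1).map f
    rw [h1] at h2
    -- Evaluating the two paths at `t = 0` recovers the base points.
    have h3 := eq_zero_of_pathEq (h2.pathEq ((represents_infinitesimal 1).map g))
    simp only [mul_zero] at h3
    exact velocity_eq_of_map_eq h3 h1
  · intro h
    refine ExtSpace.Hom.ext (funext fun x => Subtype.ext ?_)
    obtain ⟨x, c, hc, hct⟩ := x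
    exact (hc.map f).eq (hc.map g) (pathEq_comp_of_velocity_eq (mdifferentiableAt_of_hom f)
      (mdifferentiableAt_of_hom g) h hct)

end Figures

/-! ## Figures of standard tangent vectors -/

/-- The smooth map `(u, y) ↦ (u, y)` from `ℝᵐ × ℝ` to `ℝᵐ⁺¹`. -/
def snocLine {m : ℕ} (u : Euc m) (y : ℝ) : Euc (m + 1) :=
  (eucProd m 1).symm (u, y • EuclideanSpace.single (0 : Fin 1) (1 : ℝ))

theorem eucProd_snocLine {m : ℕ} (u : Euc m) (y : ℝ) :
    eucProd m 1 (snocLine u y) = (u, y • EuclideanSpace.single (0 : Fin 1) (1 : ℝ)) :=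
  (eucProd m 1).apply_symm_apply _

theorem contDiff_snocLine {m : ℕ} {E : Type*} [NormedAddCommGroup E] [NormedSpace ℝ E]
    {f : E → Euc m} {g : E → ℝ} (hf : ContDiff ℝ ∞ f) (hg : ContDiff ℝ ∞ g) :
    ContDiff ℝ ∞ (fun z => snocLine (f z) (g z)) :=
  (eucProd m 1).symm.contDiff.comp (hf.prodMk (hg.smul contDiff_const))

theorem hasDerivAt_snocLine {m : ℕ} (u : Euc m) (y : ℝ) :
    HasDerivAt (snocLine u) (snocLine 0 1) y := by
  have h1 : HasDerivAt (fun y : ℝ => (u, y • EuclideanSpace.single (0 : Fin 1) (1 : ℝ)))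
      ((0 : Euc m), (1 : ℝ) • EuclideanSpace.single (0 : Fin 1) (1 : ℝ)) y :=
    (hasDerivAt_const _ _).prodMk ((hasDerivAt_id y).smul_const _)
  exact ((eucProd m 1).symm : Euc m × Euc 1 →L[ℝ] Euc (m + 1)).hasFDerivAt.comp_hasDerivAt y h1

theorem represents_snocLine {m : ℕ} (u : Euc m) {x : Ext real} {c : ℝ → ℝ}
    (hc : Represents (X := real) c x) :
    Represents (X := euc (m + 1)) (fun t => snocLine u (c t))
      (Ext.pair (hat (X := euc m) u) (Ext.map realToEuc x)) :=
  (represents_hat (X := euc m) u).pair (hc.map realToEuc)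

attribute [irreducible] snocLine

/-- The set of pairs of a standard point of `U` and an infinitesimal multiple of the identity. -/
def lineType {m : ℕ} (U : Opens (Euc m)) : ExtType where
  dim := m + 1
  carrier := {z | ∃ u ∈ U, ∃ a : ℝ,
    z = Ext.pair (hat (X := euc m) u) (Ext.map realToEuc (infinitesimal a).1)}

namespace lineType

variable {m : ℕ} {U : Opens (Euc m)}

/-- The point of `lineType U` with the given components. -/
def mk (u : U) (a : ℝ) : lineType U :=
  ⟨Ext.pair (hat (X := euc m) u.1) (Ext.map realToEuc (infinitesimal a).1), u.1, u.2, a, rfl⟩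

theorem represents_mk (u : U) (a : ℝ) :
    Represents (X := euc (m + 1)) (fun t => snocLine u.1 (a * t)) (mk u a).1 :=
  represents_snocLine u.1 (represents_infinitesimal a)

/-- The standard part does not depend on `a`, so one neighbourhood serves all multiples of the
infinitesimal; below, `a = 0` and `a = 1` are compared in the same local form. -/
theorem mk_mem_extOpen {V : Opens (Euc (m + 1))} {u : U} (hu : snocLine u.1 0 ∈ V) (a : ℝ) :
    (mk u a).1 ∈ extOpen V := by
  refine mem_extOpen_iff.2 ?_
  rw [(represents_mk u a).st_eq, mul_zero]
  exact hu

/-- The first component. -/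
def fst (x : lineType U) : std U :=
  ⟨Ext.map (eucFst m 1) x.1, by
    obtain ⟨_, u, hu, a, rfl⟩ := x
    exact ⟨u, hu, (Ext.map_fst_pair _ _).symm⟩⟩

/-- The second component. -/
def snd (x : lineType U) : firstOrder :=
  ⟨Ext.map ((eucSnd m 1).comp eucToReal) x.1, by
    obtain ⟨_, u, hu, a, rfl⟩ := x
    rw [Ext.map_comp, Ext.map_snd_pair, eucToReal_realToEuc]
    exact (infinitesimal a).2⟩

theorem fst_mk (u : U) (a : ℝ) : fst (mk u a) = toStd u :=
  Subtype.ext (Ext.map_fst_pair _ _)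

theorem snd_mk (u : U) (a : ℝ) : snd (mk u a) = infinitesimal a := by
  refine Subtype.ext ?_
  change Ext.map ((eucSnd m 1).comp eucToReal) (Ext.pair _ _) = _
  rw [Ext.map_comp, Ext.map_snd_pair, eucToReal_realToEuc]

theorem isArrow_fst : IsArrow (lineType U) (std U) fst :=
  isArrow_of_contDiffOn (S := lineType U) (T := std U) (V := ⊤)
    (h := fun z => (eucProd m 1 z).1)
    (contDiff_fst.comp (eucProd m 1).contDiff).contDiffOn (fun _ => mem_extOpen_iff.2 trivial)
    fun _ _ hξ => hξ.map (eucFst m 1)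

theorem isFig_snd : ExtSpace.D.IsFig (lineType U) snd :=
  isFig_induced_of_map (S := lineType U) ((eucSnd m 1).comp eucToReal) fun _ => rfl

end lineType

/-! ### Figures of `T_st M` correspond to smooth families of tangent vectors -/

section Tangent

variable {n : ℕ} {M : Type u} [TopologicalSpace M] [ChartedSpace (EuclideanSpace ℝ (Fin n)) M]
  [IsManifold (𝓡 n) ∞ M]

/-- The tangent map of `K` is applied to the smooth vector field that points in the last coordinate
direction, along the slice where that coordinate is `0`. -/
theorem contMDiffAt_tangentMapWithin_snocLine {m : ℕ} {K : Euc (m + 1) → M}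
    {O : Set (Euc (m + 1))} (hK : ContMDiffOn 𝓘(ℝ, Euc (m + 1)) (𝓡 n) ∞ K O) (hO : IsOpen O)
    {u₀ : Euc m} (hu₀ : snocLine u₀ 0 ∈ O) :
    ContMDiffAt 𝓘(ℝ, Euc m) (𝓡 n).tangent ∞
      (fun u => tangentMapWithin 𝓘(ℝ, Euc (m + 1)) (𝓡 n) K O ⟨snocLine u 0, snocLine 0 1⟩) u₀ := by
  let σ : Euc m → TangentBundle 𝓘(ℝ, Euc (m + 1)) (Euc (m + 1)) :=
    fun u => ⟨snocLine u 0, snocLine 0 1⟩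
  have hσ : ContMDiff 𝓘(ℝ, Euc m) 𝓘(ℝ, Euc (m + 1)).tangent ∞ σ := by
    have h1 : ContMDiff 𝓘(ℝ, Euc (m + 1)) 𝓘(ℝ, Euc (m + 1)).tangent ∞
        (fun z => (⟨z, snocLine 0 1⟩ : TangentBundle 𝓘(ℝ, Euc (m + 1)) (Euc (m + 1)))) :=
      contMDiff_vectorSpace_iff_contDiff.2 contDiff_const
    have h2 : ContMDiff 𝓘(ℝ, Euc m) 𝓘(ℝ, Euc (m + 1)) ∞ (fun u : Euc m => snocLine u 0) :=
      (contDiff_snocLine contDiff_id contDiff_const).contMDiff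
    exact h1.comp h2
  have hT := hK.contMDiffOn_tangentMapWithin (m := ∞) (by simp) hO.uniqueMDiffOn
  have h1 : ContMDiffAt 𝓘(ℝ, Euc (m + 1)).tangent (𝓡 n).tangent ∞
      (tangentMapWithin 𝓘(ℝ, Euc (m + 1)) (𝓡 n) K O) (σ u₀) :=
    (hT (σ u₀) hu₀).contMDiffAt ((hO.preimage
      (FiberBundle.continuous_proj _ _)).mem_nhds hu₀)
  exact h1.comp u₀ hσ.contMDiffAt

-- By the chain rule, velocities in the last variable are values of the tangent map, so their smooth
-- dependence on `u` follows from the previous lemma.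
omit [IsManifold (𝓡 n) ∞ M] in
theorem velocity_comp_snocLine {m : ℕ} {K : Euc (m + 1) → M}
    {O : Set (Euc (m + 1))} (hK : ContMDiffOn 𝓘(ℝ, Euc (m + 1)) (𝓡 n) ∞ K O) (hO : IsOpen O)
    {u : Euc m} (hu : snocLine u 0 ∈ O) :
    velocity (fun y => K (snocLine u y)) =
      tangentMapWithin 𝓘(ℝ, Euc (m + 1)) (𝓡 n) K O ⟨snocLine u 0, snocLine 0 1⟩ := by
  have hKd : MDifferentiableAt 𝓘(ℝ, Euc (m + 1)) (𝓡 n) K (snocLine u 0) :=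
    ((hK _ hu).contMDiffAt (hO.mem_nhds hu)).mdifferentiableAt (by simp)
  have hj := hasDerivAt_snocLine u 0
  have hj' : MDifferentiableAt 𝓘(ℝ, ℝ) 𝓘(ℝ, Euc (m + 1)) (snocLine u) 0 :=
    hj.differentiableAt.mdifferentiableAt
  have h3 : mfderiv 𝓘(ℝ, ℝ) (𝓡 n) (fun y => K (snocLine u y)) 0 (1 : ℝ) =
      mfderivWithin 𝓘(ℝ, Euc (m + 1)) (𝓡 n) K O (snocLine u 0) (snocLine 0 1) := by
    rw [mfderivWithin_of_isOpen hO hu]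
    have h4 := mfderiv_comp_apply (0 : ℝ) hKd hj' (1 : ℝ)
    have h5 : mfderiv 𝓘(ℝ, ℝ) 𝓘(ℝ, Euc (m + 1)) (snocLine u) 0 (1 : ℝ) =
        (snocLine 0 1 : Euc (m + 1)) := by
      rw [mfderiv_eq_fderiv]
      exact hj.deriv
    rw [h5] at h4
    exact h4
  exact congrArg (Bundle.TotalSpace.mk (F := Euc n) (E := TangentSpace (𝓡 n))
    (K (snocLine u 0))) h3

omit [IsManifold (𝓡 n) ∞ M] in
theorem contMDiffAt_comp_snocLine {q m : ℕ} {H : Euc q × Euc (m + 1) → M} {p : Euc q} {u : Euc m}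
    (hH : ContMDiffAt 𝓘(ℝ, Euc q × Euc (m + 1)) (𝓡 n) ∞ H (p, snocLine u 0)) :
    ContMDiffAt 𝓘(ℝ, Euc q × ℝ) (𝓡 n) ∞ (fun z : Euc q × ℝ => H (z.1, snocLine u z.2)) (p, 0) := by
  have h1 : ContDiff ℝ ∞ (fun z : Euc q × ℝ => (z.1, snocLine u z.2)) :=
    contDiff_fst.prodMk (contDiff_snocLine contDiff_const contDiff_snd)
  exact ContMDiffAt.comp (I' := 𝓘(ℝ, Euc q × Euc (m + 1))) (p, (0 : ℝ)) (g := H)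
    (f := fun z : Euc q × ℝ => (z.1, snocLine u z.2)) hH h1.contMDiff.contMDiffAt

/-- Velocities of figures of standard tangent vectors are smooth. -/
theorem contMDiff_velocity_of_isFig {m : ℕ} {U : Opens (Euc m)}
    {f : U → CInfSpace.Hom real (ofManifold (𝓡 n) M)}
    (hf : (ofManifold (𝓡 n) M).standardTangent.IsFig U (fun u => standardTangentMk (f u))) :
    ContMDiff 𝓘(ℝ, Euc m) (𝓡 n).tangent ∞
      (fun u => (velocity (f u).toFun : TangentBundle (𝓡 n) M)) := by
  intro u₀
  -- The adjoint map `(u, h) ↦ d u h` is tested on the pairs `(u, a t)`; such test points suffice to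
  -- recover velocities.
  let δ : lineType U → ExtSpace.ext (ofManifold (𝓡 n) M) :=
    fun x => (extRestrictD (f (ofStd (lineType.fst x)))).toFun (lineType.snd x)
  have hδ : (ExtSpace.ext (ofManifold (𝓡 n) M)).IsFig (lineType U) δ :=
    hf (S := lineType U) (d := fun x => (lineType.fst x, lineType.snd x))
      ⟨lineType.isArrow_fst, lineType.isFig_snd⟩
  have hval : ∀ (u : U) (a : ℝ), (δ (lineType.mk u a)).1 =
      Ext.map (f u) (infinitesimal a).1 := by
    intro u a
    simp only [δ]
    rw [lineType.fst_mk, lineType.snd_mk, ofStd_toStd]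
    rfl
  have hfu : ∀ (u : U) (a : ℝ), Represents (X := ofManifold (𝓡 n) M) (fun t => f u (a * t))
      (Ext.map (f u) (infinitesimal a).1) := fun u a => (represents_infinitesimal a).map (f u)
  have hcont : Continuous (fun u : Euc m => snocLine u 0) :=
    (contDiff_snocLine contDiff_id contDiff_const).continuous
  obtain ⟨V, hV, hloc⟩ := exists_local_form hδ (lineType.mk u₀ 0)
  have hst : ∀ (u : U) (a : ℝ), st (n := m + 1) (lineType.mk u a).1 = snocLine u.1 0 := by
    intro u a
    rw [(lineType.represents_mk u a).st_eq, mul_zero]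
  have hV₀ : snocLine u₀.1 0 ∈ V := by
    rw [← hst u₀ 0]
    exact mem_extOpen_iff.1 hV
  have hVev : ∀ᶠ u : U in 𝓝 u₀, snocLine u.1 0 ∈ V :=
    (hcont.comp continuous_subtype_val).continuousAt.eventually_mem (V.isOpen.mem_nhds hV₀)
  rcases hloc with hconst | ⟨q, P, (O : Set (Euc q × Euc (m + 1))),
      (H : Euc q × Euc (m + 1) → M), hP, hO, hmem, hH, hrep⟩
  -- If `δ` is locally constant, nearby curves have the same value at `a = 1` and the same base
  -- point (from `a = 0`), hence the velocity is locally constant.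
  · have heq : ∀ u : U, snocLine u.1 0 ∈ V → ∀ a : ℝ,
        Ext.map (f u) (infinitesimal a).1 = Ext.map (f u₀) (infinitesimal 0).1 := by
      intro u hu a
      have h1 := congrArg Subtype.val (hconst (lineType.mk u a) (lineType.mk_mem_extOpen hu a))
      exact (hval u a).symm.trans (h1.trans (hval u₀ 0))
    suffices hev : (fun u => (velocity (f u).toFun : TangentBundle (𝓡 n) M)) =ᶠ[𝓝 u₀]
        fun _ => velocity (f u₀).toFun from
      ContMDiffAt.congr_of_eventuallyEq contMDiffAt_const hev
    filter_upwards [hVev] with u hu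
    refine velocity_eq_of_map_eq ?_ ((heq u hu 1).trans (heq u₀ hV₀ 1).symm)
    have h1 := hfu u 0
    rw [heq u hu 0] at h1
    have h2 := eq_zero_of_pathEq (h1.pathEq (hfu u₀ 0))
    simpa using h2
  · replace hmem : (P 0, snocLine u₀.1 0) ∈ O := by
      rw [← hst u₀ 0]
      exact hmem
    -- The extended parameter is frozen at its standard part; that this does not change the
    -- velocities is `velocity_eq_of_pathEq`.
    let K : Euc (m + 1) → M := fun z => H (P 0, z)
    let O' : Set (Euc (m + 1)) := {z | (P 0, z) ∈ O}
    have hO' : IsOpen O' := hO.preimage (by fun_prop : Continuous fun z : Euc (m + 1) => (P 0, z))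
    have hK : ContMDiffOn 𝓘(ℝ, Euc (m + 1)) (𝓡 n) ∞ K O' :=
      hH.comp (ContDiff.contMDiff (by fun_prop :
        ContDiff ℝ ∞ fun z : Euc (m + 1) => (P 0, z))).contMDiffOn fun z hz => hz
    have hTat : ContMDiffAt 𝓘(ℝ, Euc m) (𝓡 n).tangent ∞ (fun u : U => tangentMapWithin
        𝓘(ℝ, Euc (m + 1)) (𝓡 n) K O' ⟨snocLine u.1 0, snocLine 0 1⟩) u₀ :=
      contMDiffAt_subtype_iff.2 (contMDiffAt_tangentMapWithin_snocLine hK hO' hmem)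
    suffices hev : (fun u => (velocity (f u).toFun : TangentBundle (𝓡 n) M)) =ᶠ[𝓝 u₀]
        fun u : U => tangentMapWithin 𝓘(ℝ, Euc (m + 1)) (𝓡 n) K O'
          ⟨snocLine u.1 0, snocLine 0 1⟩ from
      ContMDiffAt.congr_of_eventuallyEq hTat hev
    filter_upwards [hVev, (hcont.comp continuous_subtype_val).continuousAt.eventually_mem
      (hO'.mem_nhds hmem)] with u huV huO
    change (P 0, snocLine u.1 0) ∈ O at huO
    have hpe : ∀ a : ℝ, (ofManifold (𝓡 n) M).PathEq (fun t => f u (a * t))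
        (fun t => H (P t, snocLine u.1 (a * t))) := by
      intro a
      have h1 := hrep (lineType.mk u a) (lineType.mk_mem_extOpen huV a) _
        (lineType.represents_mk u a)
      rw [hval] at h1
      exact (hfu u a).pathEq h1
    -- `a = 0` controls the drift of the base point caused by `P`, and `a = 1` the motion along the
    -- curve.
    have hp0 := hpe 0
    have hp1 := hpe 1
    simp only [zero_mul, one_mul] at hp0 hp1
    have hsm : ContMDiffAt 𝓘(ℝ, Euc q × ℝ) (𝓡 n) ∞
        (fun z : Euc q × ℝ => H (z.1, snocLine u.1 z.2)) (P 0, 0) :=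
      contMDiffAt_comp_snocLine ((hH _ huO).contMDiffAt (hO.mem_nhds huO))
    rw [velocity_eq_of_pathEq (H := fun z : Euc q × ℝ => H (z.1, snocLine u.1 z.2))
      (mdifferentiableAt_of_hom (f u)) hP hsm hp0 hp1]
    exact velocity_comp_snocLine hK hO' huO

/-- The extension of a figure, as a map on the extended points of its domain. -/
theorem exists_isFig_extension {X : CInfSpace.{u}} {k : ℕ} {W : Opens (Euc k)} {h : W → X}
    (hh : X.IsFig W h) {F : Euc k → X} (hF : ∀ x : W, F x = h x) :
    ∃ d : (⟨k, extOpen W⟩ : ExtType) → ExtSpace.ext X, (ExtSpace.ext X).IsFig ⟨k, extOpen W⟩ d ∧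
      ∀ (x : (⟨k, extOpen W⟩ : ExtType)) (ξ : ℝ → Euc k), Represents (X := euc k) ξ x.1 →
        Represents (fun t => F (ξ t)) (d x).1 := by
  choose y hy using fun x : (⟨k, extOpen W⟩ : ExtType) => x.2
  refine ⟨fun x => ⟨Ext.map (X.homOfFig h hh) (y x), trivial⟩,
    isFig_induced_of_isGenFig (Or.inr ⟨W, h, hh, fun x => ⟨y x, hy x, rfl⟩⟩), ?_⟩
  intro x ξ hξ
  rw [← hy x] at hξ
  exact represents_map_homOfFig hh hF hξ

/-- A smooth family of tangent vectors is locally the family of velocities of a smooth family of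
curves. -/
theorem exists_smooth_family {m : ℕ} {U : Opens (Euc m)} {a : U → TangentBundle (𝓡 n) M}
    (ha : ContMDiff 𝓘(ℝ, Euc m) (𝓡 n).tangent ∞ a) (u₀ : U) :
    ∃ (W : Opens (Euc (m + 1))) (F : Euc (m + 1) → M), snocLine u₀.1 0 ∈ W ∧
      ContMDiffOn 𝓘(ℝ, Euc (m + 1)) (𝓡 n) ∞ F W ∧
      ∀ u : U, snocLine u.1 0 ∈ W → velocity (fun y => F (snocLine u.1 y)) = a u := by
  obtain ⟨A, hA⟩ := exists_extension_opens a u₀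
  have hA' : ContMDiffOn 𝓘(ℝ, Euc m) (𝓡 n).tangent ∞ A U := by
    rw [← contMDiff_restrict_opens_iff]
    simp only [hA]
    exact ha
  set e := chartAt (Euc n) (a u₀).1
  set τ := trivializationAt (Euc n) (TangentSpace (𝓡 n) : M → Type) (a u₀).1
  have hτ : τ.source = Bundle.TotalSpace.proj ⁻¹' e.source :=
    TangentBundle.trivializationAt_source _
  have hU' := hA'.continuousOn.isOpen_inter_preimage U.isOpen τ.open_source
  set U' : Set (Euc m) := U ∩ A ⁻¹' τ.source
  have hbase : ∀ {x}, x ∈ U' → (A x).1 ∈ e.source := by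
    intro x hx
    have h1 : A x ∈ τ.source := hx.2
    rwa [hτ] at h1
  have hp : ContDiffOn ℝ ∞ (fun x => e (A x).1) U' := by
    refine ContMDiffOn.contDiffOn (ContMDiffOn.comp (I' := 𝓡 n) (t := e.source)
      (contMDiffOn_chart (I := 𝓡 n)) ?_ fun x hx => hbase hx)
    exact (Bundle.contMDiff_proj (TangentSpace (𝓡 n) : M → Type)).comp_contMDiffOn
      (hA'.mono inter_subset_left)
  have hb : ContDiffOn ℝ ∞ (fun x => (τ (A x)).2) U' := by
    have h1 : ContMDiffOn 𝓘(ℝ, Euc m) ((𝓡 n).prod 𝓘(ℝ, Euc n)) ∞ (fun x => τ (A x)) U' :=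
      (Bundle.Trivialization.contMDiffOn (IB := 𝓡 n) τ).comp (hA'.mono inter_subset_left)
        inter_subset_right
    exact ContMDiffOn.contDiffOn (contMDiff_snd.comp_contMDiffOn h1)
  -- In coordinates, the straight line through the base point with the given fibre coordinate as
  -- direction. It can leave the chart target, hence the restriction to `W` below.
  let G : Euc (m + 1) → Euc n := fun z =>
    e (A (eucProd m 1 z).1).1 + (eucProd m 1 z).2 0 • (τ (A (eucProd m 1 z).1)).2
  let B : Set (Euc (m + 1)) := {z | (eucProd m 1 z).1 ∈ U'}
  have hfst : ContDiff ℝ ∞ (fun z : Euc (m + 1) => (eucProd m 1 z).1) :=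
    contDiff_fst.comp (eucProd m 1).contDiff
  have hsnd : ContDiff ℝ ∞ (fun z : Euc (m + 1) => (eucProd m 1 z).2 0) :=
    (by fun_prop : ContDiff ℝ ∞ fun z : Euc 1 => z 0).comp
      (contDiff_snd.comp (eucProd m 1).contDiff)
  have hB : IsOpen B := hU'.preimage hfst.continuous
  have hG : ContDiffOn ℝ ∞ G B :=
    (hp.comp hfst.contDiffOn fun z hz => hz).add
      (hsnd.contDiffOn.smul (hb.comp hfst.contDiffOn fun z hz => hz))
  have hGs : ∀ u y, G (snocLine u y) = e (A u).1 + y • (τ (A u)).2 := by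
    intro u y
    simp only [G, eucProd_snocLine]
    simp
  have hBs : ∀ u y, snocLine u y ∈ B ↔ u ∈ U' := by
    intro u y
    change (eucProd m 1 (snocLine u y)).1 ∈ U' ↔ _
    rw [eucProd_snocLine]
  let W : Opens (Euc (m + 1)) := ⟨_, hG.continuousOn.isOpen_inter_preimage hB e.open_target⟩
  have hF : ContMDiffOn 𝓘(ℝ, Euc (m + 1)) (𝓡 n) ∞ (fun z => e.symm (G z)) W :=
    (contMDiffOn_chart_symm (I := 𝓡 n)).comp (hG.contMDiffOn.mono inter_subset_left)
      inter_subset_right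
  refine ⟨W, _, ⟨(hBs _ _).2 ⟨u₀.2, ?_⟩, ?_⟩, hF, ?_⟩
  · rw [mem_preimage, hA, hτ]
    exact mem_chart_source _ _
  · rw [mem_preimage, hGs, zero_smul, add_zero, hA]
    exact mem_chart_target _ _
  · intro u hu
    have hu' : u.1 ∈ U' := (hBs _ _).1 hu.1
    have hbu := hbase hu'
    rw [← hA u]
    have h0 : e.symm (G (snocLine u.1 0)) = (A u).1 := by
      rw [hGs, zero_smul, add_zero, e.left_inv hbu]
    have hsn : ContMDiff 𝓘(ℝ, ℝ) 𝓘(ℝ, Euc (m + 1)) ∞ (fun y => snocLine u.1 y) :=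
      (contDiff_snocLine contDiff_const contDiff_id).contMDiff
    have hFd : ContMDiffAt 𝓘(ℝ, ℝ) (𝓡 n) ∞ (fun y => e.symm (G (snocLine u.1 y))) 0 :=
      ContMDiffAt.comp (0 : ℝ) (g := fun z => e.symm (G z)) (f := fun y => snocLine u.1 y)
        ((hF _ hu).contMDiffAt (W.isOpen.mem_nhds hu)) hsn.contMDiffAt
    have hd : HasDerivAt (e ∘ fun y => e.symm (G (snocLine u.1 y))) (τ (A u)).2 0 := by
      have h1 : HasDerivAt (fun y : ℝ => e (A u).1 + y • (τ (A u)).2) (τ (A u)).2 0 := by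
        simpa using ((hasDerivAt_id (0 : ℝ)).smul_const (τ (A u)).2).const_add (e (A u).1)
      refine h1.congr_of_eventuallyEq ?_
      have h2 : ∀ᶠ y : ℝ in 𝓝 0, snocLine u.1 y ∈ W :=
        hsn.continuous.continuousAt.eventually_mem (W.isOpen.mem_nhds hu)
      filter_upwards [h2] with y hy
      change e (e.symm (G (snocLine u.1 y))) = _
      rw [e.right_inv hy.2, hGs]
    have hm : e.symm (G (snocLine u.1 0)) ∈ e.source := by rwa [h0]
    refine eq_of_trivializationAt_eq (m := (a u₀).1) hm hbu ?_
    rw [trivializationAt_velocity (hFd.mdifferentiableAt (by simp)) hm hd]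
    refine Prod.ext ?_ rfl
    change e.symm (G (snocLine u.1 0)) = _
    rw [h0]
    exact (τ.coe_fst hu'.2).symm

/-- Smooth families of velocities are figures of standard tangent vectors. -/
theorem isFig_of_contMDiff_velocity {m : ℕ} {U : Opens (Euc m)}
    {f : U → CInfSpace.Hom real (ofManifold (𝓡 n) M)}
    (hf : ContMDiff 𝓘(ℝ, Euc m) (𝓡 n).tangent ∞
      (fun u => (velocity (f u).toFun : TangentBundle (𝓡 n) M))) :
    (ofManifold (𝓡 n) M).standardTangent.IsFig U (fun u => standardTangentMk (f u)) := by
  intro R δ hδ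
  obtain ⟨hs, hx⟩ := hδ
  refine (ExtSpace.ext (ofManifold (𝓡 n) M)).fig_local fun r₀ => ?_
  obtain ⟨W, F, hW₀, hF, hvel⟩ := exists_smooth_family hf (ofStd (δ r₀).1)
  obtain ⟨d, hd, hdF⟩ := exists_isFig_extension (X := ofManifold (𝓡 n) M)
    (contMDiff_restrict_opens_iff.2 hF) (F := F) fun _ => rfl
  -- The test figure `(u, h)` of the product becomes one arrow into extended points of `ℝᵐ⁺¹`, to
  -- which `•F` can be applied.
  have hζ := isArrow_pair hs (isArrow_map_of_isFig hx realToEuc)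
  have hrep : ∀ (r : R) (c : ℝ → ℝ), Represents (X := real) c (δ r).2.1 →
      Represents (X := euc (m + 1)) (fun t => snocLine (ofStd (δ r).1).1 (c t))
        (Ext.pair (δ r).1.1 (Ext.map realToEuc (δ r).2.1)) := by
    intro r c hc
    have h1 := represents_snocLine (ofStd (δ r).1).1 hc
    have h2 : hat (X := euc m) (ofStd (δ r).1).1 = (δ r).1.1 :=
      congrArg Subtype.val (toStd_ofStd (δ r).1)
    rwa [h2] at h1
  have hst : ∀ r : R, st (n := m + 1) (Ext.pair (δ r).1.1 (Ext.map realToEuc (δ r).2.1)) =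
      snocLine (ofStd (δ r).1).1 0 := by
    intro r
    obtain ⟨c, hc, hct⟩ := (δ r).2.2
    rw [(hrep r c hc).st_eq]
    obtain ⟨C, hC⟩ := hct.bound
    have : c 0 = 0 := by simpa using hC.self_of_nhds
    rw [this]
  obtain ⟨V, hV, hVW⟩ := hζ.continuous W r₀ (mem_extOpen_iff.2 (by
    change st (n := m + 1) (Ext.pair (δ r₀).1.1 (Ext.map realToEuc (δ r₀).2.1)) ∈ W
    rw [hst]
    exact hW₀))
  refine ⟨V, hV, ?_⟩
  have hζ' : IsArrow (R.inter V) ⟨m + 1, extOpen W⟩ (fun r =>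
      ⟨Ext.pair (δ (R.interIncl V r)).1.1 (Ext.map realToEuc (δ (R.interIncl V r)).2.1),
        hVW _ r.2.2⟩) := (isArrow_interIncl R V).comp hζ
  -- It remains to see that `•F` after the pairing is the given family. For each fixed point this
  -- compares two curves with equal velocity on an element of `D`.
  convert (ExtSpace.ext (ofManifold (𝓡 n) M)).fig_comp hd hζ' using 1
  funext r
  refine Subtype.ext ?_
  set r' := R.interIncl V r
  obtain ⟨c, hc, hct⟩ := (δ r').2.2
  have hW : snocLine (ofStd (δ r').1).1 0 ∈ W := by
    rw [← hst r']
    exact mem_extOpen_iff.1 (hVW r' r.2.2)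
  have h1 := hdF ⟨_, hVW _ r.2.2⟩ _ (hrep r' c hc)
  have h2 := hc.map (f (ofStd (δ r').1))
  refine h2.eq h1 ?_
  have hsn : ContMDiff 𝓘(ℝ, ℝ) 𝓘(ℝ, Euc (m + 1)) ∞ (fun y => snocLine (ofStd (δ r').1).1 y) :=
    (contDiff_snocLine contDiff_const contDiff_id).contMDiff
  have hFd : ContMDiffAt 𝓘(ℝ, ℝ) (𝓡 n) ∞ (fun y => F (snocLine (ofStd (δ r').1).1 y)) 0 :=
    ContMDiffAt.comp (0 : ℝ) (g := F) (f := fun y => snocLine (ofStd (δ r').1).1 y)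
      ((hF _ hW).contMDiffAt (W.isOpen.mem_nhds hW)) hsn.contMDiffAt
  exact pathEq_comp_of_velocity_eq (g := fun y => F (snocLine (ofStd (δ r').1).1 y))
    (mdifferentiableAt_of_hom _) (hFd.mdifferentiableAt (by simp)) (hvel _ hW).symm hct

/-- The velocity of a standard tangent vector. -/
def velocityOfStandardTangent (t : (ofManifold (𝓡 n) M).standardTangent) :
    TangentBundle (𝓡 n) M :=
  velocity t.2.choose.toFun

omit [IsManifold (𝓡 n) ∞ M] in
theorem standardTangentMk_choose (t : (ofManifold (𝓡 n) M).standardTangent) :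
    standardTangentMk t.2.choose = t :=
  Subtype.ext t.2.choose_spec.symm

/-- The chosen curve may differ from `f`, but it defines the same standard tangent vector and so has
the same velocity. -/
theorem velocityOfStandardTangent_mk (f : CInfSpace.Hom real (ofManifold (𝓡 n) M)) :
    velocityOfStandardTangent (standardTangentMk f) = velocity f.toFun :=
  extRestrictD_eq_iff.1 (congrArg Subtype.val (standardTangentMk_choose (standardTangentMk f)))

/-- The curve with a given velocity. -/
def curveOfTangent (a : TangentBundle (𝓡 n) M) : CInfSpace.Hom real (ofManifold (𝓡 n) M) :=
  Hom.ofContMDiff _ (exists_curve_velocity_eq a).choose_spec.1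

theorem velocity_curveOfTangent (a : TangentBundle (𝓡 n) M) :
    velocity (curveOfTangent a).toFun = a :=
  (exists_curve_velocity_eq a).choose_spec.2

/-- The isomorphism between standard tangent vectors and tangent vectors. -/
def standardTangentIso : (ofManifold (𝓡 n) M).standardTangent ≅
    ofManifold (𝓡 n).tangent (TangentBundle (𝓡 n) M) where
  hom := CInfSpace.Hom.mk velocityOfStandardTangent (by
    intro m U d hd
    refine contMDiff_velocity_of_isFig (f := fun u => (d u).2.choose) ?_
    simp only [standardTangentMk_choose]
    exact hd)
  inv := CInfSpace.Hom.mk (fun a => standardTangentMk (curveOfTangent a)) (by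
    intro m U d hd
    refine isFig_of_contMDiff_velocity (f := fun u => curveOfTangent (d u)) ?_
    have h : (fun u => velocity (curveOfTangent (d u)).toFun) = d :=
      funext fun u => velocity_curveOfTangent (d u)
    rw [h]
    exact hd)
  hom_inv_id := CInfSpace.Hom.ext (funext fun t => by
    change standardTangentMk (curveOfTangent (velocityOfStandardTangent t)) = t
    -- Both sides are now classes of curves with the same velocity.
    conv_rhs => rw [← standardTangentMk_choose t]
    exact Subtype.ext (extRestrictD_eq_iff.2 (velocity_curveOfTangent _)))
  inv_hom_id := CInfSpace.Hom.ext (funext fun a => by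
    change velocityOfStandardTangent (standardTangentMk (curveOfTangent a)) = a
    rw [velocityOfStandardTangent_mk, velocity_curveOfTangent])

end Tangent
end InfDiffGeo
end

open InfDiffGeo
theorem mainTheorem7 {n : ℕ} (M : Type*) [TopologicalSpace M]
    [ChartedSpace (EuclideanSpace ℝ (Fin n)) M] [IsManifold (𝓡 n) ∞ M] :
    ∃ Φ : (CInfSpace.ofManifold (𝓡 n) M).standardTangent ≅
        CInfSpace.ofManifold (𝓡 n).tangent (TangentBundle (𝓡 n) M),
      ∀ (f : ℝ → M) (hf : ContMDiff 𝓘(ℝ, ℝ) (𝓡 n) ∞ f),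
        Φ.hom.toFun (CInfSpace.standardTangentMk (CInfSpace.Hom.ofContMDiff f hf)) =
          ⟨f 0, mfderiv 𝓘(ℝ, ℝ) (𝓡 n) f 0 (1 : ℝ)⟩ := by
  exact ⟨standardTangentIso, fun f hf =>
    velocityOfStandardTangent_mk (CInfSpace.Hom.ofContMDiff f hf)⟩
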